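/- Let $N\ge 1$, $p,q>1$, $a,b>0$, and let $G_1,G_2\in C^1(\mathbb{R})$ satisfy $G_1(0)=G_2(0)=0$, $G_1(\sigma)\ge a|\sigma|^p$ and $G_2(\sigma)\ge b|\sigma|^q$ for all $\sigma\in\mathbb{R}$. Let $f_1,g_1,f_2,g_2\in C_c^\infty(\mathbb{R}^N)$ with $\int_{\mathbb{R}^N} g_1\,dx>0$ and $\int_{\mathbb{R}^N} g_2\,dx>0$, and put $r_0=\sup\{|x| : x\in\operatorname{supp}(f_1,f_2,g_1,g_2)\}$. For $\varepsilon>0$ and $T>0$ consider the system $$\partial_t^2u-\Delta u=G_1(\partial_tv),\qquad \partial_t^2v-\Delta v=G_2(\partial_tu)\qquad\text{in }\mathbb{R}^N\times(0,T),$$ $$(u,\partial_tu)(0)=(\varepsilon f_1,\varepsilon g_1),\qquad (v,\partial_tv)(0)=(\varepsilon f_2,\varepsilon g_2).$$ A weak solution in $(0,T)$ is a pair $u,v\in C([0,T);H^1(\mathbb{R}^N))\cap C^1([0,T);L^2(\mathbb{R}^N))$ with $G_2(\partial_tu),G_1(\partial_tv)\in L^1(0,T;L^1(\mathbb{R}^N))$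 that attains these initial values and satisfies, for every $\Psi\in C_c^\infty(\mathbb{R}^N\times[0,T))$, $$\varepsilon\int_{\mathbb{R}^N} g_1\Psi(\cdot,0)\,dx+\int_0^T\!\!\int_{\mathbb{R}^N} G_1(\partial_tv)\Psi\,dx\,dt=\int_0^T\!\!\int_{\mathbb{R}^N}\big(-\partial_tu\,\partial_t\Psi+\nabla u\cdot\nabla\Psi\big)\,dx\,dt,$$ $$\varepsilon\int_{\mathbb{R}^N} g_2\Psi(\cdot,0)\,dx+\int_0^T\!\!\int_{\mathbb{R}^N} G_2(\partial_tu)\Psi\,dx\,dt=\int_0^T\!\!\int_{\mathbb{R}^N}\big(-\partial_tv\,\partial_t\Psi+\nabla v\cdot\nabla\Psi\big)\,dx\,dt.$$ Set $$F_{GG}(N,p,q)=\frac{p+1}{pq-1}-\frac{N-1}{2},\qquad \Gamma=\max\{F_{GG}(N,p,q),F_{GG}(N,q,p)\},$$ and assume $\Gamma\ge 0$. Then there are constants $\varepsilon_0>0$ and $C>0$, independent of $\varepsilon$, of $T$ and of the solution, such that for every $\varepsilon\in(0,\varepsilon_0]$, every $T>0$ and every weak solution $(u,v)$ in $(0,T)$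 with $\operatorname{supp}(u,v)\subset\{(x,t)\in\mathbb{R}^N\times[0,T) : |x|\le r_0+t\}$ one has $$T\le\begin{cases} C\varepsilon^{-\Gamma^{-1}} & \text{if }\Gamma>0,\\ \exp\big(C\varepsilon^{-(pq-1)}\big) & \text{if }\Gamma=0,\ p\ne q,\\ \exp\big(C\varepsilon^{-(p-1)}\big) & \text{if }\Gamma=0,\ p=q.\end{cases}$$ -/

import Mathlib

open MeasureTheory Set
open scoped ContDiff

namespace WaveSystem

/-- The space `ℝ^N` with its Euclidean norm. -/
abbrev Space (N : ℕ) : Type := EuclideanSpace ℝ (Fin N)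

/-- `F ∈ L²(ℝ^N; ℝ^N)` is the weak gradient of `w ∈ L²(ℝ^N)`:
`∫ w ∇φ = - ∫ φ F` for every `φ ∈ C_c^∞(ℝ^N)`. -/
def IsWeakGradient {N : ℕ} (w : Lp ℝ 2 (volume : Measure (Space N)))
    (F : Lp (Space N) 2 (volume : Measure (Space N))) : Prop :=
  ∀ φ : Space N → ℝ, ContDiff ℝ ∞ φ → HasCompactSupport φ →
    ∫ x, w x • gradient φ x = - ∫ x, φ x • F x

lemma continuous_gradient {N : ℕ} {φ : Space N → ℝ} (hφ : ContDiff ℝ ∞ φ) :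
    Continuous (gradient φ) :=
  (InnerProductSpace.toDual ℝ (Space N)).symm.continuous.comp
    (hφ.continuous_fderiv (by simp))

lemma hasCompactSupport_gradient {N : ℕ} {φ : Space N → ℝ} (hφ : HasCompactSupport φ) :
    HasCompactSupport (gradient φ) :=
  (hφ.fderiv (𝕜 := ℝ)).comp_left (g := (InnerProductSpace.toDual ℝ (Space N)).symm) (map_zero _)

lemma integrable_smul_gradient {N : ℕ} (w : Lp ℝ 2 (volume : Measure (Space N)))
    {φ : Space N → ℝ} (hφ : ContDiff ℝ ∞ φ) (hc : HasCompactSupport φ) :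
    Integrable (fun x => w x • gradient φ x) := by
  have h1 : MemLp (gradient φ) 2 (volume : Measure (Space N)) :=
    (continuous_gradient hφ).memLp_of_hasCompactSupport (hasCompactSupport_gradient hc)
  exact memLp_one_iff_integrable.1 (h1.smul (Lp.memLp w))

lemma integrable_smul_field {N : ℕ} (F : Lp (Space N) 2 (volume : Measure (Space N)))
    {φ : Space N → ℝ} (hφ : ContDiff ℝ ∞ φ) (hc : HasCompactSupport φ) :
    Integrable (fun x => φ x • F x) := by
  have h1 : MemLp φ 2 (volume : Measure (Space N)) :=
    hφ.continuous.memLp_of_hasCompactSupport hc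
  exact memLp_one_iff_integrable.1 ((Lp.memLp F).smul h1)

/-- The Sobolev space `H¹(ℝ^N)`, realized as the space of pairs `(w, ∇w)` in
`L²(ℝ^N) × L²(ℝ^N; ℝ^N)` with `∇w` the weak gradient of `w`. The norm inherited from the product,
`max (‖w‖, ‖∇w‖)`, is equivalent to the usual `H¹` norm. -/
def H1 (N : ℕ) : Submodule ℝ (Lp ℝ 2 (volume : Measure (Space N)) ×
    Lp (Space N) 2 (volume : Measure (Space N))) where
  carrier := {z | IsWeakGradient z.1 z.2}
  zero_mem' := by
    intro φ _ _
    have h1 : (fun x => ((0 : Lp ℝ 2 (volume : Measure (Space N))) x) • gradient φ x)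
        =ᵐ[volume] fun _ => (0 : Space N) := by
      filter_upwards [Lp.coeFn_zero ℝ 2 (volume : Measure (Space N))] with x _
      simp
    have h2 : (fun x => φ x • ((0 : Lp (Space N) 2 (volume : Measure (Space N))) x))
        =ᵐ[volume] fun _ => (0 : Space N) := by
      filter_upwards [Lp.coeFn_zero (Space N) 2 (volume : Measure (Space N))] with x _
      simp
    change ∫ x, ((0 : Lp ℝ 2 (volume : Measure (Space N))) x) • gradient φ x
      = - ∫ x, φ x • ((0 : Lp (Space N) 2 (volume : Measure (Space N))) x)
    rw [integral_congr_ae h1, integral_congr_ae h2]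
    simp
  add_mem' := by
    rintro ⟨w, F⟩ ⟨w', F'⟩ h h' φ hφ hc
    have h1 : (fun x => (w + w') x • gradient φ x)
        =ᵐ[volume] fun x => w x • gradient φ x + w' x • gradient φ x := by
      filter_upwards [Lp.coeFn_add w w'] with x hx
      rw [hx, Pi.add_apply, add_smul]
    have h2 : (fun x => φ x • (F + F') x)
        =ᵐ[volume] fun x => φ x • F x + φ x • F' x := by
      filter_upwards [Lp.coeFn_add F F'] with x hx
      rw [hx, Pi.add_apply, smul_add]
    change ∫ x, (w + w') x • gradient φ x = - ∫ x, φ x • (F + F') x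
    rw [integral_congr_ae h1, integral_congr_ae h2,
      integral_add (integrable_smul_gradient w hφ hc) (integrable_smul_gradient w' hφ hc),
      integral_add (integrable_smul_field F hφ hc) (integrable_smul_field F' hφ hc),
      neg_add]
    exact congrArg₂ (· + ·) (h φ hφ hc) (h' φ hφ hc)
  smul_mem' := by
    rintro c ⟨w, F⟩ h φ hφ hc
    have h1 : (fun x => (c • w) x • gradient φ x)
        =ᵐ[volume] fun x => c • (w x • gradient φ x) := by
      filter_upwards [Lp.coeFn_smul c w] with x hx
      rw [hx, Pi.smul_apply, smul_assoc]
    have h2 : (fun x => φ x • (c • F) x)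
        =ᵐ[volume] fun x => c • (φ x • F x) := by
      filter_upwards [Lp.coeFn_smul c F] with x hx
      rw [hx, Pi.smul_apply, smul_comm]
    change ∫ x, (c • w) x • gradient φ x = - ∫ x, φ x • (c • F) x
    rw [integral_congr_ae h1, integral_congr_ae h2, integral_smul, integral_smul, ← smul_neg]
    exact congrArg (c • ·) (h φ hφ hc)

/-- The function `w ∈ L²(ℝ^N)` underlying an element of `H¹(ℝ^N)`. -/
def valH1 {N : ℕ} (z : H1 N) : Lp ℝ 2 (volume : Measure (Space N)) := z.1.1

/-- The weak gradient of an element of `H¹(ℝ^N)`. -/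
def gradH1 {N : ℕ} (z : H1 N) : Lp (Space N) 2 (volume : Measure (Space N)) := z.1.2

/-- `u ∈ C([0,T); H¹(ℝ^N)) ∩ C¹([0,T); L²(ℝ^N))`. -/
def IsEnergyClass {N : ℕ} (T : ℝ) (u : ℝ → H1 N) : Prop :=
  ContinuousOn u (Ico 0 T) ∧ ContDiffOn ℝ 1 (fun t => valH1 (u t)) (Ico 0 T)

/-- The time derivative `∂ₜu(t) ∈ L²(ℝ^N)` of a curve on `[0,T)` (one-sided at `t = 0`). -/
noncomputable def timeDeriv {N : ℕ} (T : ℝ) (u : ℝ → H1 N) (t : ℝ) :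
    Lp ℝ 2 (volume : Measure (Space N)) :=
  derivWithin (fun s => valH1 (u s)) (Ico 0 T) t

/-- `h ∈ L¹(0,T; L¹(ℝ^N))` (a Bochner space), for a family `h(t)` of functions on `ℝ^N`. -/
def MemL1L1 {N : ℕ} (T : ℝ) (h : ℝ → Space N → ℝ) : Prop :=
  ∃ k : ℝ → Lp ℝ 1 (volume : Measure (Space N)), IntegrableOn k (Ioo 0 T) ∧
    ∀ᵐ t ∂(volume.restrict (Ioo 0 T)), k t =ᵐ[volume] h t

/-- `Ψ ∈ C_c^∞(ℝ^N × [0,T))`: the restriction to `t ≥ 0` of a smooth function on `ℝ^N × ℝ` with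
compact support in `ℝ^N × (-∞,T)`. -/
def IsTestFunction {N : ℕ} (T : ℝ) (Ψ : Space N × ℝ → ℝ) : Prop :=
  ContDiff ℝ ∞ Ψ ∧ HasCompactSupport Ψ ∧ tsupport Ψ ⊆ {z | z.2 < T}

/-- The weak form on `ℝ^N × [0,T)` of `∂ₜ²u - Δu = h` with initial velocity `u₁`. -/
def WeakWaveEquation {N : ℕ} (T : ℝ) (u : ℝ → H1 N) (h : ℝ → Space N → ℝ)
    (u₁ : Space N → ℝ) : Prop :=
  ∀ Ψ : Space N × ℝ → ℝ, IsTestFunction T Ψ →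
    (∫ x, u₁ x * Ψ (x, 0)) + (∫ t in Ioo 0 T, ∫ x, h t x * Ψ (x, t))
      = ∫ t in Ioo 0 T, ∫ x,
          (-(timeDeriv T u t x * deriv (fun s => Ψ (x, s)) t)
            + inner ℝ (gradH1 (u t) x) (gradient (fun y => Ψ (y, t)) x))

/-- `(u, v)` is a weak solution in `(0,T)` of
`∂ₜ²u - Δu = G₁(∂ₜv)`, `∂ₜ²v - Δv = G₂(∂ₜu)`,
`(u, ∂ₜu)(0) = (ε f₁, ε g₁)`, `(v, ∂ₜv)(0) = (ε f₂, ε g₂)`. -/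
structure IsWeakSolution {N : ℕ} (G₁ G₂ : ℝ → ℝ) (f₁ g₁ f₂ g₂ : Space N → ℝ) (ε T : ℝ)
    (u v : ℝ → H1 N) : Prop where
  energy_u : IsEnergyClass T u
  energy_v : IsEnergyClass T v
  memL1_u : MemL1L1 T (fun t x => G₂ (timeDeriv T u t x))
  memL1_v : MemL1L1 T (fun t x => G₁ (timeDeriv T v t x))
  init_u : valH1 (u 0) =ᵐ[volume] fun x => ε * f₁ x
  init_v : valH1 (v 0) =ᵐ[volume] fun x => ε * f₂ x
  init_ut : timeDeriv T u 0 =ᵐ[volume] fun x => ε * g₁ x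
  init_vt : timeDeriv T v 0 =ᵐ[volume] fun x => ε * g₂ x
  weak_u : WeakWaveEquation T u (fun t x => G₁ (timeDeriv T v t x)) (fun x => ε * g₁ x)
  weak_v : WeakWaveEquation T v (fun t x => G₂ (timeDeriv T u t x)) (fun x => ε * g₂ x)

/-- `r₀ = sup {|x| ; x ∈ supp (f₁, f₂, g₁, g₂)}`. -/
noncomputable def dataRadius {N : ℕ} (f₁ g₁ f₂ g₂ : Space N → ℝ) : ℝ :=
  sSup ((fun x => ‖x‖) '' (tsupport f₁ ∪ tsupport f₂ ∪ tsupport g₁ ∪ tsupport g₂))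

/-- `supp u ⊆ {(x,t) ∈ ℝ^N × [0,T) ; |x| ≤ r + t}`. As the cone is closed and `u` is continuous in
time with values in `L²`, this says that each `u(t)` vanishes almost everywhere on `|x| > r + t`. -/
def SupportedInCone {N : ℕ} (r T : ℝ) (u : ℝ → H1 N) : Prop :=
  ∀ t ∈ Ico 0 T, ∀ᵐ x ∂(volume : Measure (Space N)), r + t < ‖x‖ → valH1 (u t) x = 0

/-- The exponent `F_GG(N,p,q) = (p+1)/(pq-1) - (N-1)/2`. -/
noncomputable def FGG (N : ℕ) (p q : ℝ) : ℝ :=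
  (p + 1) / (p * q - 1) - ((N : ℝ) - 1) / 2

/-- The exponent `Γ_GG(N,p,q) = max {F_GG(N,p,q), F_GG(N,q,p)}`. -/
noncomputable def GammaGG (N : ℕ) (p q : ℝ) : ℝ :=
  max (FGG N p q) (FGG N q p)

end WaveSystem

open WaveSystem

namespace WaveSystem

/-! The equations are tested against the plane wave `exp (k x·e)`, an eigenfunction of the Laplacian
with eigenvalue `k²`, cut off beyond the cone. With `A` and `B` the moments of `∂ₜu` and `u`, and
`H` that of `G₁(∂ₜv)`, this yields `B' = A` and, weakly, `B'' = k² B + H`. Since `H ≥ 0`, Duhamel's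
formula (`cosh_duhamel_le`) bounds `X(t) = exp (-k t) A(t)` below by a data term plus half the
integral of `exp (-k s) H(s)`. The data term involves `∫ g ± k ∫ f` with exponential weights,
positive for small `k > 0` because `∫ g > 0`; no sign of `f` is needed.

By finite propagation, `∂ₜv(s)` lives in a ball of radius `r + s`, where the plane wave has mass
`O(exp (k s) (1+s)^κ)`, `κ = (N-1)/2` (`setIntegral_exp_closedBall_le`). Jensen's inequality
(`rpow_abs_integral_le`) then gives, with `Y` the analogous moment of `v`, `X(t) ≥ ε d + c ∫₀ᵗ
(1+s)^(-κ(p-1)) |Y|^p ds`, and the same with `X, Y` and `p, q` exchanged.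

What remains is an ODE-type blow-up argument. If `X ≥ M` from time `τ` on, one pass through each
inequality gives `X ≥ const · τ^θ M^(pq)` after a multiplicative delay, where `θ = p + 1 - κ(pq-1) =
(pq-1) F_GG`. So `X` doubles over and over, with logarithmic delays summing like a geometric series,
which bounds `T` (`exists_lifespan_bound`). For `θ > 0` the iteration starts at `τ₀ = ε^(-1/F_GG)`,
for `θ = 0` at `τ₀ = 1`. If `p = q` and `θ = 0`, both weights are `(1+s)⁻¹` and every single pass
gains a logarithm, whence the better exponent (`lifespan_bound_of_log_weight`). -/

/-! ### Blow-up for the coupled integral inequalities -/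

/-- The integral inequality `X(t) ≥ m + c ∫₀ᵗ (1+s)^{-γ} |Y(s)|^p ds` on `[0,T)`. -/
def DominatesIntegral (T m c γ p : ℝ) (X Y : ℝ → ℝ) : Prop :=
  ∀ t ∈ Ico 0 T, m + c * ∫ s in (0 : ℝ)..t, (1 + s) ^ (-γ) * |Y s| ^ p ≤ X t

lemma DominatesIntegral.initial_le {T m c γ p : ℝ} {X Y : ℝ → ℝ}
    (h : DominatesIntegral T m c γ p X Y) (hc : 0 ≤ c) {t : ℝ} (ht : t ∈ Ico 0 T) : m ≤ X t := by
  refine le_trans ?_ (h t ht)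
  have : 0 ≤ ∫ s in (0 : ℝ)..t, (1 + s) ^ (-γ) * |Y s| ^ p := by
    refine intervalIntegral.integral_nonneg ht.1 fun s hs => ?_
    have : 0 ≤ 1 + s := by linarith [hs.1]
    positivity
  nlinarith

lemma DominatesIntegral.integral_le {T m c γ p : ℝ} {X Y : ℝ → ℝ}
    (h : DominatesIntegral T m c γ p X Y) (hY : ContinuousOn Y (Ico 0 T)) (hm : 0 ≤ m)
    (hc : 0 ≤ c) (hp : 0 ≤ p) {t₀ t : ℝ} (h0 : 0 ≤ t₀) (h1 : t₀ ≤ t) (hT : t < T) {g : ℝ → ℝ}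
    (hg : ContinuousOn g (Icc t₀ t))
    (hle : ∀ s ∈ Icc t₀ t, g s ≤ (1 + s) ^ (-γ) * |Y s| ^ p) :
    c * ∫ s in t₀..t, g s ≤ X t := by
  have hcont : ContinuousOn (fun s => (1 + s) ^ (-γ) * |Y s| ^ p) (Icc 0 t) := by
    refine ContinuousOn.mul ?_ ?_
    · refine ContinuousOn.rpow_const (by fun_prop) fun s hs => Or.inl ?_
      have := hs.1
      positivity
    · exact ((hY.mono fun s hs => ⟨hs.1, hs.2.trans_lt hT⟩).abs).rpow_const fun s _ => Or.inr hp
  have hint : ∀ a b, 0 ≤ a → a ≤ b → b ≤ t →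
      IntervalIntegrable (fun s => (1 + s) ^ (-γ) * |Y s| ^ p) volume a b := fun a b ha hab hb =>
    (hcont.mono (Icc_subset_Icc ha hb)).intervalIntegrable_of_Icc hab
  have hsplit := intervalIntegral.integral_add_adjacent_intervals
    (hint 0 t₀ le_rfl h0 h1) (hint t₀ t h0 h1 le_rfl)
  have hpos : 0 ≤ ∫ s in (0 : ℝ)..t₀, (1 + s) ^ (-γ) * |Y s| ^ p := by
    refine intervalIntegral.integral_nonneg h0 fun s hs => ?_
    have : 0 ≤ 1 + s := by linarith [hs.1]
    positivity
  have hmono := intervalIntegral.integral_mono_on h1 (hg.intervalIntegrable_of_Icc h1)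
    (hint t₀ t h0 h1 le_rfl) hle
  have := h t ⟨h0.trans h1, hT⟩
  nlinarith

/-- A function that doubles after each multiplication of time by `exp (L k)`, with `∑ L k ≤ S`,
cannot live longer than `τ₀ exp S`. -/
lemma le_mul_exp_of_doubling {T τ₀ S M₀ : ℝ} {X : ℝ → ℝ} {L : ℕ → ℝ} (hτ₀ : 1 ≤ τ₀)
    (hM₀ : 0 < M₀) (hL : ∀ k, 0 ≤ L k) (hS : ∀ n, ∑ k ∈ Finset.range n, L k ≤ S)
    (base : ∀ t ∈ Ico 0 T, τ₀ ≤ 1 + t → M₀ ≤ X t)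
    (step : ∀ k τ, τ₀ ≤ τ → (∀ t ∈ Ico 0 T, τ ≤ 1 + t → 2 ^ k * M₀ ≤ X t) →
      ∀ t ∈ Ico 0 T, Real.exp (L k) * τ ≤ 1 + t → 2 ^ (k + 1) * M₀ ≤ X t) :
    1 + T ≤ τ₀ * Real.exp S := by
  by_contra! hlt
  have hgrow : ∀ n, ∀ t ∈ Ico 0 T,
      τ₀ * Real.exp (∑ k ∈ Finset.range n, L k) ≤ 1 + t → 2 ^ n * M₀ ≤ X t := by
    intro n
    induction n with
    | zero => simpa using base
    | succ n ih =>
      intro t ht h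
      refine step n (τ₀ * Real.exp (∑ k ∈ Finset.range n, L k)) ?_ ih t ht ?_
      · exact le_mul_of_one_le_right (by linarith)
          (Real.one_le_exp (Finset.sum_nonneg fun k _ => hL k))
      · rw [Finset.sum_range_succ, Real.exp_add] at h
        linarith
  have hS0 : 0 ≤ S := by simpa using hS 0
  -- All delays have elapsed by this one time, so `X` there would exceed `2^n M₀` for every `n`.
  have ht : τ₀ * Real.exp S - 1 ∈ Ico 0 T := by
    have := Real.one_le_exp hS0
    constructor <;> nlinarith
  obtain ⟨n, hn⟩ := pow_unbounded_of_one_lt (X (τ₀ * Real.exp S - 1) / M₀) one_lt_two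
  have h := hgrow n _ ht (by
    have := Real.exp_le_exp.2 (hS n)
    nlinarith)
  rw [div_lt_iff₀ hM₀] at hn
  linarith

lemma sum_geometric_le {r C : ℝ} (h0 : 0 ≤ r) (h1 : r < 1) (hC : 0 ≤ C) (n : ℕ) :
    ∑ k ∈ Finset.range n, C * r ^ k ≤ C * (1 - r)⁻¹ := by
  rw [← Finset.mul_sum, ← tsum_geometric_of_lt_one h0 h1]
  exact mul_le_mul_of_nonneg_left
    ((summable_geometric_of_lt_one h0 h1).sum_le_tsum _ fun k _ => pow_nonneg h0 k) hC

/-- With `ρ = exp L` the right side is the gain `(1 - ρ⁻¹)^p log ρ` of one double pass, so a gain of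
order `Z` costs a delay `Z + Z^(1/(p+1))`. The first term serves large `L`, where `1 - exp (-L) ≥
1/2`; the second serves `L ≤ 1`, where the gain is of order `L^(p+1)`. -/
lemma div_le_one_sub_exp_neg_rpow_mul {Z p : ℝ} (hZ : 0 < Z) (hp : 0 < p) :
    Z / 2 ^ p ≤ (1 - Real.exp (-(Z + Z ^ (1 / (p + 1))))) ^ p * (Z + Z ^ (1 / (p + 1))) := by
  have hW : 0 < Z ^ (1 / (p + 1)) := Real.rpow_pos_of_pos hZ _
  set W := Z ^ (1 / (p + 1)) with hWdef
  set L := Z + W with hLdef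
  have hL : 0 < L := by positivity
  have hexp : L / (1 + L) ≤ 1 - Real.exp (-L) := by
    have h1 : 1 + L ≤ Real.exp L := by linarith [Real.add_one_le_exp L]
    have h2 : Real.exp (-L) ≤ (1 + L)⁻¹ := by
      rw [Real.exp_neg]
      exact inv_anti₀ (by positivity) h1
    have h3 : L / (1 + L) = 1 - (1 + L)⁻¹ := by field_simp; ring
    linarith
  have key : Z / 2 ^ p ≤ (L / (1 + L)) ^ p * L := by
    rcases le_total 1 L with h | h
    · have h1 : (1 / 2 : ℝ) ≤ L / (1 + L) := by
        rw [div_le_div_iff₀ (by norm_num) (by positivity)]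
        linarith
      calc Z / 2 ^ p = (1 / 2 : ℝ) ^ p * Z := by
            rw [Real.div_rpow zero_le_one zero_le_two, Real.one_rpow]; ring
        _ ≤ (L / (1 + L)) ^ p * L := by gcongr; linarith
    · have h1 : L / 2 ≤ L / (1 + L) := by gcongr; linarith
      calc Z / 2 ^ p = W ^ (p + 1) / 2 ^ p := by
            rw [hWdef, ← Real.rpow_mul hZ.le, one_div, inv_mul_cancel₀ (by positivity),
              Real.rpow_one]
        _ ≤ L ^ (p + 1) / 2 ^ p := by gcongr; linarith
        _ = (L / 2) ^ p * L := by
            rw [Real.rpow_add_one hL.ne', Real.div_rpow hL.le zero_le_two]; ring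
        _ ≤ (L / (1 + L)) ^ p * L := by gcongr
  refine key.trans ?_
  gcongr

/-- The decreasing weight is at least its value at `s`, and the window from `τ - 1` to `s` has
length at least `(1 - ρ⁻¹)(1+s)` once `1 + s ≥ ρ τ`. -/
lemma DominatesIntegral.growth_first {κ c m T q M τ ρ : ℝ} {X Y : ℝ → ℝ}
    (hY : DominatesIntegral T m c (κ * (q - 1)) q Y X) (hX : ContinuousOn X (Ico 0 T))
    (hq : 1 < q) (hκ : 0 ≤ κ) (hc : 0 < c) (hm : 0 ≤ m) (hM : 0 < M)
    (hτ : 1 ≤ τ) (hρ : 1 < ρ) (hXM : ∀ t ∈ Ico 0 T, τ ≤ 1 + t → M ≤ X t)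
    {s : ℝ} (hs : s ∈ Ico 0 T) (hτs : ρ * τ ≤ 1 + s) :
    c * M ^ q * (1 - ρ⁻¹) * (1 + s) ^ (1 - κ * (q - 1)) ≤ Y s := by
  have hs1 : 0 < 1 + s := by nlinarith
  have hle := hY.integral_le hX hm hc.le (by linarith) (t₀ := τ - 1) (t := s)
    (g := fun _ => (1 + s) ^ (-(κ * (q - 1))) * M ^ q) (by linarith) (by nlinarith) hs.2
    (by fun_prop) (fun σ hσ => by
      have h1 : 0 < 1 + σ := by linarith [hσ.1]
      have h2 : M ≤ X σ :=
        hXM σ ⟨by linarith [hσ.1], hσ.2.trans_lt hs.2⟩ (by linarith [hσ.1])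
      have h3 : M ≤ |X σ| := h2.trans (le_abs_self _)
      have h4 : (1 + s) ^ (-(κ * (q - 1))) ≤ (1 + σ) ^ (-(κ * (q - 1))) := by
        refine Real.rpow_le_rpow_of_nonpos h1 (by linarith [hσ.2]) ?_
        have : 0 ≤ κ * (q - 1) := mul_nonneg hκ (by linarith)
        linarith
      gcongr)
  rw [intervalIntegral.integral_const, smul_eq_mul] at hle
  refine le_trans ?_ hle
  have h5 : (1 - ρ⁻¹) * (1 + s) ≤ s - (τ - 1) := by
    have : τ ≤ ρ⁻¹ * (1 + s) := by
      rw [inv_mul_eq_div, le_div_iff₀ (by linarith)]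
      linarith
    linarith
  calc c * M ^ q * (1 - ρ⁻¹) * (1 + s) ^ (1 - κ * (q - 1))
      = c * (((1 - ρ⁻¹) * (1 + s)) * ((1 + s) ^ (-(κ * (q - 1))) * M ^ q)) := by
        rw [show 1 - κ * (q - 1) = -(κ * (q - 1)) + 1 by ring, Real.rpow_add_one hs1.ne']
        ring
    _ ≤ _ := by gcongr

/-- Inserting the bound of `growth_first` for `Y` makes the integrand of order `(1+s)^(θ-1)`, `θ = p
+ 1 - κ(pq-1)`. As `θ ≥ 0`, this is at least `τ^θ / (1+s)`, whose integral from `ρτ - 1` to `t`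
supplies the factor `log ρ`. -/
lemma DominatesIntegral.growth_second {κ c m m' T p q M τ ρ : ℝ} {X Y : ℝ → ℝ}
    (hXd : DominatesIntegral T m c (κ * (p - 1)) p X Y)
    (hYd : DominatesIntegral T m' c (κ * (q - 1)) q Y X)
    (hX : ContinuousOn X (Ico 0 T)) (hY : ContinuousOn Y (Ico 0 T))
    (hp : 1 < p) (hq : 1 < q) (hκ : 0 ≤ κ) (hθ : 0 ≤ p + 1 - κ * (p * q - 1))
    (hc : 0 < c) (hm : 0 ≤ m) (hm' : 0 ≤ m') (hM : 0 < M)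
    (hτ : 1 ≤ τ) (hρ : 1 < ρ) (hXM : ∀ t ∈ Ico 0 T, τ ≤ 1 + t → M ≤ X t)
    {t : ℝ} (ht : t ∈ Ico 0 T) (hτt : ρ * (ρ * τ) ≤ 1 + t) :
    c ^ (p + 1) * τ ^ (p + 1 - κ * (p * q - 1)) * M ^ (p * q) *
      ((1 - ρ⁻¹) ^ p * Real.log ρ) ≤ X t := by
  have hρτ : 1 ≤ ρ * τ := by nlinarith
  have hρ' : 0 < 1 - ρ⁻¹ := by
    have := inv_lt_one_of_one_lt₀ hρ
    linarith
  have hle1 : ρ * τ ≤ 1 + t := by nlinarith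
  set D := c ^ p * M ^ (p * q) * (1 - ρ⁻¹) ^ p * τ ^ (p + 1 - κ * (p * q - 1)) with hD
  have hD0 : 0 ≤ D := by positivity
  have hle := hXd.integral_le hY hm hc.le (by linarith) (t₀ := ρ * τ - 1) (t := t)
    (g := fun s => D * (1 + s)⁻¹) (by linarith) (by linarith) ht.2
    (by
      refine continuousOn_const.mul (ContinuousOn.inv₀ (by fun_prop) fun s hs => ?_)
      have := hs.1
      linarith)
    (fun s hs => by
      have hs1 : 0 < 1 + s := by linarith [hs.1]
      have h1 := hYd.growth_first hX hq hκ hc hm' hM hτ hρ hXM (s := s)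
        ⟨by linarith [hs.1], hs.2.trans_lt ht.2⟩ (by linarith [hs.1])
      have h2 := h1.trans (le_abs_self _)
      have h3 : (c * M ^ q * (1 - ρ⁻¹) * (1 + s) ^ (1 - κ * (q - 1))) ^ p ≤ |Y s| ^ p := by
        gcongr
      have hτs : τ ^ (p + 1 - κ * (p * q - 1)) ≤ (1 + s) ^ (p + 1 - κ * (p * q - 1)) := by
        refine Real.rpow_le_rpow (by linarith) ?_ hθ
        nlinarith [hs.1]
      calc D * (1 + s)⁻¹
          ≤ c ^ p * M ^ (p * q) * (1 - ρ⁻¹) ^ p * (1 + s) ^ (p + 1 - κ * (p * q - 1))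
              * (1 + s)⁻¹ := by
            rw [hD]
            gcongr
        _ = (1 + s) ^ (-(κ * (p - 1))) *
              (c * M ^ q * (1 - ρ⁻¹) * (1 + s) ^ (1 - κ * (q - 1))) ^ p := by
            rw [Real.mul_rpow (by positivity) (by positivity),
              Real.mul_rpow (by positivity) (by positivity),
              Real.mul_rpow (by positivity) (by positivity), ← Real.rpow_mul hM.le,
              ← Real.rpow_mul hs1.le, mul_comm q p,
              show p + 1 - κ * (p * q - 1) = 1 + (-(κ * (p - 1)) + (1 - κ * (q - 1)) * p) by ring,
              Real.rpow_add hs1, Real.rpow_add hs1, Real.rpow_one]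
            field_simp
        _ ≤ _ := by gcongr)
  have hint : ∫ s in (ρ * τ - 1)..t, D * (1 + s)⁻¹ = D * Real.log ((1 + t) / (ρ * τ)) := by
    rw [intervalIntegral.integral_const_mul,
      intervalIntegral.integral_comp_add_left (fun x : ℝ => x⁻¹) 1,
      integral_inv_of_pos (by linarith) (by linarith)]
    ring_nf
  rw [hint] at hle
  refine le_trans ?_ hle
  have hlog : Real.log ρ ≤ Real.log ((1 + t) / (ρ * τ)) := by
    refine Real.log_le_log (by linarith) ?_
    rw [le_div_iff₀ (by linarith)]
    exact hτt
  have hlogρ : 0 ≤ Real.log ρ := Real.log_nonneg hρ.le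
  calc _ = c * (D * Real.log ρ) := by rw [Real.rpow_add_one hc.ne', hD]; ring
    _ ≤ _ := by gcongr

/-- Lifespan bound for the coupled integral inequalities, in terms of the size `M₀` of `X` after
the time `τ₀`. -/
theorem exists_lifespan_bound {κ c p q : ℝ} (hp : 1 < p) (hq : 1 < q) (hκ : 0 ≤ κ)
    (hθ : 0 ≤ p + 1 - κ * (p * q - 1)) (hc : 0 < c) :
    ∃ K : ℝ, 0 < K ∧ ∀ (T m m' M₀ τ₀ : ℝ) (X Y : ℝ → ℝ), 0 ≤ m → 0 ≤ m' → 0 < M₀ → 1 ≤ τ₀ →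
      M₀ ≤ m →
      ContinuousOn X (Ico 0 T) → ContinuousOn Y (Ico 0 T) →
      DominatesIntegral T m c (κ * (p - 1)) p X Y →
      DominatesIntegral T m' c (κ * (q - 1)) q Y X →
      1 + T ≤ τ₀ * Real.exp (K *
        ((τ₀ ^ (p + 1 - κ * (p * q - 1)) * M₀ ^ (p * q - 1))⁻¹ +
          ((τ₀ ^ (p + 1 - κ * (p * q - 1)) * M₀ ^ (p * q - 1))⁻¹) ^ (1 / (p + 1)))) := by
  have hpq : 0 < p * q - 1 := by nlinarith
  set θ := p + 1 - κ * (p * q - 1) with hθdef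
  -- Doubling `M` multiplies `M^(-(pq-1))`, hence the required gain, by `r`; its root, by `r'`. Both
  -- ratios are below one.
  set r : ℝ := 2 ^ (-(p * q - 1)) with hr
  have hr0 : 0 < r := by positivity
  have hr1 : r < 1 := Real.rpow_lt_one_of_one_lt_of_neg one_lt_two (by linarith)
  set r' : ℝ := r ^ (1 / (p + 1)) with hr'
  have hr'0 : 0 < r' := by positivity
  have hr'1 : r' < 1 := Real.rpow_lt_one hr0.le hr1 (by positivity)
  -- The gain needed at level `k` is exactly `A E⁻¹ r^k / 2^p`: the `2` is for doubling, `c^(p+1)`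
  -- comes from `growth_second`, and `2^p` cancels the loss in `div_le_one_sub_exp_neg_rpow_mul`.
  set A : ℝ := 2 ^ p * (2 / c ^ (p + 1)) with hA
  have hA0 : 0 < A := by positivity
  have h1r : 0 < 1 - r := by linarith
  have h1r' : 0 < 1 - r' := by linarith
  set K₁ := 2 * (A * (1 - r)⁻¹) with hK₁
  set K₂ := 2 * (A ^ (1 / (p + 1)) * (1 - r')⁻¹) with hK₂
  have hK₁0 : 0 < K₁ := by positivity
  have hK₂0 : 0 < K₂ := by positivity
  refine ⟨K₁ + K₂, by positivity, ?_⟩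
  intro T m m' M₀ τ₀ X Y hm hm' hM₀ hτ₀ hMm hX hY hXd hYd
  have hτ₀' : 0 < τ₀ := by linarith
  set E := τ₀ ^ θ * M₀ ^ (p * q - 1) with hE
  have hE0 : 0 < E := by positivity
  set Z := A * E⁻¹ with hZ
  have hZ0 : 0 < Z := by positivity
  -- The factor `2` is there because a double pass consumes `ρ` twice.
  set L : ℕ → ℝ := fun k => 2 * (Z * r ^ k + (Z * r ^ k) ^ (1 / (p + 1))) with hL
  have hLsum : ∀ n, ∑ k ∈ Finset.range n, L k ≤
      (K₁ + K₂) * (E⁻¹ + (E⁻¹) ^ (1 / (p + 1))) := by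
    intro n
    have h1 := sum_geometric_le hr0.le hr1 hZ0.le n
    have h2 := sum_geometric_le hr'0.le hr'1 (Real.rpow_nonneg hZ0.le (1 / (p + 1))) n
    have h3 : ∀ k, (Z * r ^ k) ^ (1 / (p + 1)) = Z ^ (1 / (p + 1)) * r' ^ k := by
      intro k
      rw [Real.mul_rpow hZ0.le (by positivity), hr', ← Real.rpow_natCast, ← Real.rpow_natCast,
        ← Real.rpow_mul hr0.le, ← Real.rpow_mul hr0.le, mul_comm (k : ℝ)]
    have h4 : ∑ k ∈ Finset.range n, L k ≤
        2 * (Z * (1 - r)⁻¹) + 2 * (Z ^ (1 / (p + 1)) * (1 - r')⁻¹) := by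
      simp only [hL, h3]
      rw [← Finset.mul_sum, Finset.sum_add_distrib]
      linarith
    refine h4.trans ?_
    have hE1 : 0 < E⁻¹ := by positivity
    have hE2 : 0 < (E⁻¹) ^ (1 / (p + 1)) := by positivity
    rw [hZ, Real.mul_rpow hA0.le hE1.le]
    have e1 : 2 * (A * E⁻¹ * (1 - r)⁻¹) = K₁ * E⁻¹ := by rw [hK₁]; ring
    have e2 : 2 * (A ^ (1 / (p + 1)) * (E⁻¹) ^ (1 / (p + 1)) * (1 - r')⁻¹)
        = K₂ * (E⁻¹) ^ (1 / (p + 1)) := by rw [hK₂]; ring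
    rw [e1, e2]
    nlinarith [mul_pos hK₁0 hE2, mul_pos hK₂0 hE1]
  refine le_mul_exp_of_doubling (X := X) (L := L) (M₀ := M₀) hτ₀ hM₀ (fun k => by positivity)
    hLsum (fun t ht _ => hMm.trans (hXd.initial_le hc.le ht)) ?_
  intro k τ hτ hXM t ht hτt
  set W := Z * r ^ k with hW
  have hW0 : 0 < W := by positivity
  set ℓ := W + W ^ (1 / (p + 1)) with hℓ
  have hℓ0 : 0 < ℓ := by positivity
  have hgrow := hXd.growth_second hYd hX hY hp hq hκ hθ hc hm hm' (M := 2 ^ k * M₀) (τ := τ)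
    (ρ := Real.exp ℓ) (by positivity) (by linarith) (Real.one_lt_exp_iff.2 hℓ0) hXM ht (by
      rw [← mul_assoc, ← Real.exp_add]
      convert hτt using 4
      simp only [hL]
      ring)
  refine le_trans ?_ hgrow
  rw [Real.log_exp, ← Real.exp_neg]
  have hkey := div_le_one_sub_exp_neg_rpow_mul hW0 (p := p) (by linarith)
  have hττ : τ₀ ^ θ ≤ τ ^ θ := Real.rpow_le_rpow hτ₀'.le hτ hθ
  have hrk : r ^ k = ((2 : ℝ) ^ k) ^ (-(p * q - 1)) := by
    rw [hr, ← Real.rpow_natCast, ← Real.rpow_natCast, ← Real.rpow_mul zero_le_two,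
      ← Real.rpow_mul zero_le_two, mul_comm]
  have h2k : (0 : ℝ) < 2 ^ k := by positivity
  have hτ' : 0 < τ := by linarith
  calc (2 : ℝ) ^ (k + 1) * M₀
      = c ^ (p + 1) * τ₀ ^ θ * (2 ^ k * M₀) ^ (p * q) * (W / 2 ^ p) := by
        rw [hW, hZ, hE, hA, hrk, Real.mul_rpow h2k.le hM₀.le, Real.rpow_neg h2k.le,
          show p * q = (p * q - 1) + 1 by ring, Real.rpow_add_one h2k.ne',
          Real.rpow_add_one hM₀.ne', add_sub_cancel_right, pow_succ]
        have a1 : c ^ (p + 1) ≠ 0 := by positivity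
        have a2 : τ₀ ^ θ ≠ 0 := by positivity
        have a3 : ((2 : ℝ) ^ k) ^ (p * q - 1) ≠ 0 := by positivity
        have a4 : M₀ ^ (p * q - 1) ≠ 0 := by positivity
        have a5 : (2 : ℝ) ^ p ≠ 0 := by positivity
        field_simp
    _ ≤ c ^ (p + 1) * τ ^ θ * (2 ^ k * M₀) ^ (p * q) *
          ((1 - Real.exp (-ℓ)) ^ p * ℓ) := by
        gcongr

/-- Lifespan bound for the symmetric system with the critical weight `(1+s)⁻¹`. -/
theorem lifespan_bound_of_log_weight {c p m T : ℝ} {X Y : ℝ → ℝ} (hp : 1 < p) (hc : 0 < c)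
    (hm : 0 < m)
    (hX : ContinuousOn X (Ico 0 T)) (hY : ContinuousOn Y (Ico 0 T))
    (hXd : DominatesIntegral T m c 1 p X Y) (hYd : DominatesIntegral T m c 1 p Y X) :
    1 + T ≤ Real.exp (2 / c * (1 - 2 ^ (-(p - 1)))⁻¹ * m ^ (-(p - 1))) := by
  set r : ℝ := 2 ^ (-(p - 1)) with hr
  have hr0 : 0 < r := by positivity
  have hr1 : r < 1 := Real.rpow_lt_one_of_one_lt_of_neg one_lt_two (by linarith)
  -- A window of logarithmic length `λ` turns the level `M` into `c M^p λ`; for `M = 2^k m` this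
  -- equals `2 M` when `λ = Z r^k`.
  set Z := 2 / c * m ^ (-(p - 1)) with hZ
  have hZ0 : 0 < Z := by positivity
  have hstep : ∀ (k : ℕ) (τ : ℝ), 1 ≤ τ → ∀ U V : ℝ → ℝ, ContinuousOn V (Ico 0 T) →
      DominatesIntegral T m c 1 p U V →
      (∀ t ∈ Ico 0 T, τ ≤ 1 + t → 2 ^ k * m ≤ V t) →
      ∀ t ∈ Ico 0 T, Real.exp (Z * r ^ k) * τ ≤ 1 + t → 2 ^ (k + 1) * m ≤ U t := by
    intro k τ hτ U V hV hUV hVM t ht hτt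
    have hexp : 1 ≤ Real.exp (Z * r ^ k) := Real.one_le_exp (by positivity)
    have hττ : τ ≤ 1 + t := by nlinarith
    have h2k : (0 : ℝ) < 2 ^ k := by positivity
    have hle := hUV.integral_le hV hm.le hc.le (by linarith) (t₀ := τ - 1) (t := t)
      (g := fun s => (2 ^ k * m) ^ p * (1 + s)⁻¹) (by linarith) (by linarith) ht.2
      (by
        refine continuousOn_const.mul (ContinuousOn.inv₀ (by fun_prop) fun s hs => ?_)
        have := hs.1
        linarith)
      (fun s hs => by
        have hs1 : 0 < 1 + s := by linarith [hs.1]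
        have h1 := (hVM s ⟨by linarith [hs.1], hs.2.trans_lt ht.2⟩
          (by linarith [hs.1])).trans (le_abs_self _)
        rw [Real.rpow_neg_one, mul_comm]
        gcongr)
    rw [intervalIntegral.integral_const_mul,
      intervalIntegral.integral_comp_add_left (fun x : ℝ => x⁻¹) 1,
      integral_inv_of_pos (by linarith) (by linarith), add_sub_cancel] at hle
    refine le_trans ?_ hle
    have hlog : Z * r ^ k ≤ Real.log ((1 + t) / τ) := by
      rw [Real.le_log_iff_exp_le (by apply div_pos <;> linarith), le_div_iff₀ (by linarith)]
      exact hτt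
    have hrk : r ^ k = ((2 : ℝ) ^ k) ^ (-(p - 1)) := by
      rw [hr, ← Real.rpow_natCast, ← Real.rpow_natCast, ← Real.rpow_mul zero_le_two,
        ← Real.rpow_mul zero_le_two, mul_comm]
    calc (2 : ℝ) ^ (k + 1) * m = c * ((2 ^ k * m) ^ p * (Z * r ^ k)) := by
          rw [hZ, hrk, Real.mul_rpow h2k.le hm.le, Real.rpow_neg h2k.le, Real.rpow_neg hm.le]
          rw [show (2 ^ k : ℝ) ^ p = (2 ^ k : ℝ) ^ (p - 1) * 2 ^ k by
              rw [← Real.rpow_add_one h2k.ne', sub_add_cancel],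
            show m ^ p = m ^ (p - 1) * m by
              rw [← Real.rpow_add_one hm.ne', sub_add_cancel]]
          have a3 : ((2 : ℝ) ^ k) ^ (p - 1) ≠ 0 := by positivity
          have a4 : m ^ (p - 1) ≠ 0 := by positivity
          field_simp
          ring
      _ ≤ _ := by gcongr
  -- The symmetric system doubles both functions in the same window, so the argument is run on their
  -- minimum.
  have h := le_mul_exp_of_doubling (T := T) (τ₀ := 1) (M₀ := m) (X := fun t => min (X t) (Y t))
    (L := fun k => Z * r ^ k) (S := Z * (1 - r)⁻¹) le_rfl hm (fun k => by positivity)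
    (sum_geometric_le hr0.le hr1 hZ0.le)
    (fun t ht _ => le_min (hXd.initial_le hc.le ht) (hYd.initial_le hc.le ht))
    (fun k τ hτ hM t ht hτt => le_min
      (hstep k τ hτ X Y hY hXd (fun s hs h => (le_min_iff.1 (hM s hs h)).2) t ht hτt)
      (hstep k τ hτ Y X hX hYd (fun s hs h => (le_min_iff.1 (hM s hs h)).1) t ht hτt))
  rw [one_mul] at h
  convert h using 2
  rw [hZ]
  ring

/-! ### Duhamel's inequality for the moments -/

lemma exists_continuousOn_le_add {T e t₁ : ℝ} {Q : ℝ → ℝ} (hQ : ContinuousOn Q (Ico 0 T))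
    (he : 0 < e) (ht₁ : t₁ ∈ Ico 0 T) :
    ∃ δ, 0 < δ ∧ t₁ + δ < T ∧ ∀ s ∈ Icc t₁ (t₁ + δ), Q s ≤ Q t₁ + e := by
  obtain ⟨δ, hδ, h⟩ := Metric.continuousOn_iff.1 hQ t₁ ht₁ e he
  have hT : 0 < T - t₁ := by linarith [ht₁.2]
  refine ⟨min (δ / 2) ((T - t₁) / 2), by positivity, ?_, fun s hs => ?_⟩
  · have := min_le_right (δ / 2) ((T - t₁) / 2)
    linarith
  · have h1 := min_le_left (δ / 2) ((T - t₁) / 2)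
    have h2 := min_le_right (δ / 2) ((T - t₁) / 2)
    have h3 := h s ⟨ht₁.1.trans hs.1, by linarith [hs.2]⟩ (by
      rw [Real.dist_eq, abs_lt]
      constructor <;> linarith [hs.1, hs.2])
    rw [Real.dist_eq, abs_lt] at h3
    linarith [h3.2]

/-- The Duhamel formula (as an inequality, for a nonnegative source) for the scalar equation
`B'' = k² B + H` given in weak form, with `A = B'`. -/
theorem cosh_duhamel_le {T k A₀ : ℝ} {A B H : ℝ → ℝ} (hA : ContinuousOn A (Ico 0 T))
    (hB : ∀ t ∈ Ico 0 T, HasDerivWithinAt B (A t) (Ico 0 T) t)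
    (hH : IntegrableOn H (Ioo 0 T)) (hH0 : ∀ᵐ t ∂volume.restrict (Ioo 0 T), 0 ≤ H t)
    (hweak : ∀ η : ℝ → ℝ, ContDiff ℝ ∞ η → HasCompactSupport η → tsupport η ⊆ Iio T →
      A₀ * η 0 + ∫ t in Ioo 0 T, η t * H t
        = ∫ t in Ioo 0 T, (-(deriv η t * A t) - k ^ 2 * (η t * B t)))
    {t₁ : ℝ} (ht₁ : t₁ ∈ Ico 0 T) :
    A₀ * Real.cosh (k * t₁) + k * B 0 * Real.sinh (k * t₁)
      + ∫ s in Ioc 0 t₁, Real.cosh (k * (t₁ - s)) * H s ≤ A t₁ := by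
  refine le_of_forall_pos_le_add fun e he => ?_
  have hBc : ContinuousOn B (Ico 0 T) := fun t ht => (hB t ht).continuousWithinAt
  -- For `H = 0`, `Q` would be constant in `s`; at `s = t₁` it is `A t₁`.
  set Q : ℝ → ℝ := fun s => Real.cosh (k * (t₁ - s)) * A s + k * Real.sinh (k * (t₁ - s)) * B s
    with hQ
  have hQc : ContinuousOn Q (Ico 0 T) := by
    refine ContinuousOn.add (ContinuousOn.mul ?_ hA) (ContinuousOn.mul ?_ hBc) <;> fun_prop
  obtain ⟨δ, hδ, hδT, hQle⟩ := exists_continuousOn_le_add hQc he ht₁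
  have hQt : Q t₁ = A t₁ := by simp [hQ]
  rw [hQt] at hQle
  set b := t₁ + δ with hb
  have hb0 : 0 < b := by linarith [ht₁.1]
  -- A smooth step from `1` to `0` on `[t₁, b]`: `-θ'` is a probability density there, which
  -- replaces evaluation at `t₁` by an average.
  set θ : ℝ → ℝ := fun s => Real.smoothTransition ((b - s) / δ) with hθ
  have hθs : ContDiff ℝ ∞ θ := Real.smoothTransition.contDiff.comp (by fun_prop)
  have hθd : Differentiable ℝ θ := hθs.differentiable (by simp)
  have hθ'c : Continuous (deriv θ) := hθs.continuous_deriv (by simp)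
  have hθ1 : ∀ s ≤ t₁, θ s = 1 := fun s hs =>
    Real.smoothTransition.one_of_one_le (by rw [le_div_iff₀ hδ]; linarith)
  have hθ0 : ∀ s, b ≤ s → θ s = 0 := fun s hs =>
    Real.smoothTransition.zero_of_nonpos (div_nonpos_of_nonpos_of_nonneg (by linarith) hδ.le)
  have hθanti : Antitone θ := fun x y hxy =>
    Real.smoothTransition.monotone (by gcongr)
  have hθ' : ∀ s, deriv θ s ≤ 0 := fun s => hθanti.deriv_nonpos
  have hθ'0 : ∀ s < t₁, deriv θ s = 0 := fun s hs => by
    have : θ =ᶠ[nhds s] fun _ => 1 := by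
      filter_upwards [Iio_mem_nhds hs] with x hx using hθ1 x (le_of_lt hx)
    rw [this.deriv_eq, deriv_const]
  -- The last factor is `1` for `s ≥ -1` and `0` for `s ≤ -2`: it only makes the support compact.
  set η : ℝ → ℝ := fun s => θ s * Real.cosh (k * (t₁ - s)) * Real.smoothTransition (s + 2) with hη
  have hηs : ContDiff ℝ ∞ η := by
    refine (hθs.mul ?_).mul (Real.smoothTransition.contDiff.comp (by fun_prop))
    exact Real.contDiff_cosh.comp (by fun_prop)
  have hηsupp : Function.support η ⊆ Icc (-2) b := by
    intro s hs
    by_contra hcon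
    rw [mem_Icc, not_and_or, not_le, not_le] at hcon
    refine hs ?_
    rcases hcon with h | h
    · simp [hη, Real.smoothTransition.zero_of_nonpos (x := s + 2) (by linarith)]
    · simp [hη, hθ0 s h.le]
  have hηts : tsupport η ⊆ Icc (-2) b := closure_minimal hηsupp isClosed_Icc
  have hηeq : ∀ s, -1 ≤ s → η s = θ s * Real.cosh (k * (t₁ - s)) := fun s hs => by
    simp [hη, Real.smoothTransition.one_of_one_le (x := s + 2) (by linarith)]
  have hcosh : ∀ s, HasDerivAt (fun s => Real.cosh (k * (t₁ - s)))
      (-(k * Real.sinh (k * (t₁ - s)))) s := fun s => by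
    have := (((hasDerivAt_id' s).const_sub t₁).const_mul k).cosh
    convert this using 1
    ring
  have hsinh : ∀ s, HasDerivAt (fun s => Real.sinh (k * (t₁ - s)))
      (-(k * Real.cosh (k * (t₁ - s)))) s := fun s => by
    have := (((hasDerivAt_id' s).const_sub t₁).const_mul k).sinh
    convert this using 1
    ring
  have hηd : ∀ s, 0 ≤ s → deriv η s =
      deriv θ s * Real.cosh (k * (t₁ - s)) - θ s * (k * Real.sinh (k * (t₁ - s))) := by
    intro s hs
    have h1 : η =ᶠ[nhds s] fun s => θ s * Real.cosh (k * (t₁ - s)) := by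
      filter_upwards [Ioi_mem_nhds (show -1 < s by linarith)] with x hx using hηeq x (le_of_lt hx)
    rw [h1.deriv_eq]
    refine ((hθd s).hasDerivAt.mul (hcosh s)).deriv.trans ?_
    ring
  have hηd0 : ∀ s, b < s → deriv η s = 0 := fun s hs => by
    have : η =ᶠ[nhds s] fun _ => 0 := by
      filter_upwards [Ioi_mem_nhds hs] with x hx
      simp [hη, hθ0 x (le_of_lt hx)]
    rw [this.deriv_eq, deriv_const]
  have hw := hweak η hηs (HasCompactSupport.intro' isCompact_Icc isClosed_Icc
    fun x hx => Function.notMem_support.1 fun h => hx (hηsupp h))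
    (hηts.trans fun x hx => hx.2.trans_lt hδT)
  rw [hηeq 0 (by norm_num), hθ1 0 ht₁.1, one_mul, sub_zero] at hw
  have hIcc : Icc 0 b ⊆ Ico 0 T := fun x hx => ⟨hx.1, hx.2.trans_lt hδT⟩
  have hAc := hA.mono hIcc
  have hBc' := hBc.mono hIcc
  have hQc' := hQc.mono hIcc
  -- The derivative of `θ(s) k sinh (k(t₁-s)) B(s)`. The weak right-hand side is `-θ' Q + R'`, so
  -- `R'` contributes only its boundary value at `0`.
  set R' : ℝ → ℝ := fun s => (deriv θ s * (k * Real.sinh (k * (t₁ - s)))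
    + θ s * (k * -(k * Real.cosh (k * (t₁ - s))))) * B s
    + θ s * (k * Real.sinh (k * (t₁ - s))) * A s with hR'
  have hR'c : ContinuousOn R' (Icc 0 b) := by
    refine ContinuousOn.add (ContinuousOn.mul ?_ hBc') (ContinuousOn.mul ?_ hAc)
    · have := hθs.continuous; fun_prop
    · have := hθs.continuous; fun_prop
  have hRint : ∫ s in (0 : ℝ)..b, R' s = -(k * B 0 * Real.sinh (k * t₁)) := by
    rw [intervalIntegral.integral_eq_sub_of_hasDerivAt_of_le hb0.le
      (f := fun s => θ s * (k * Real.sinh (k * (t₁ - s))) * B s)]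
    · simp [hθ0 b le_rfl, hθ1 0 ht₁.1]; ring
    · refine ContinuousOn.mul ?_ hBc'
      have := hθs.continuous; fun_prop
    · intro s hs
      have hBs : HasDerivAt B (A s) s := (hB s ⟨hs.1.le, hs.2.trans hδT⟩).hasDerivAt
        (Ico_mem_nhds hs.1 (hs.2.trans hδT))
      exact (((hθd s).hasDerivAt.mul ((hsinh s).const_mul k))).mul hBs
    · exact hR'c.intervalIntegrable_of_Icc hb0.le
  have hθQc : ContinuousOn (fun s => -deriv θ s * Q s) (Icc 0 b) :=
    ContinuousOn.mul (by fun_prop) hQc'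
  have hrhs : ∫ t in Ioo 0 T, (-(deriv η t * A t) - k ^ 2 * (η t * B t))
      = (∫ s in (0 : ℝ)..b, -deriv θ s * Q s) + ∫ s in (0 : ℝ)..b, R' s := by
    rw [← intervalIntegral.integral_add (hθQc.intervalIntegrable_of_Icc hb0.le)
      (hR'c.intervalIntegrable_of_Icc hb0.le), intervalIntegral.integral_of_le hb0.le]
    rw [setIntegral_eq_of_subset_of_forall_sdiff_eq_zero (s := Ioc 0 b) measurableSet_Ioo]
    · refine setIntegral_congr_fun measurableSet_Ioc fun s hs => ?_
      simp only [hηd s hs.1.le, hηeq s (by linarith [hs.1]), hQ, hR']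
      ring
    · exact fun x hx => ⟨hx.1, hx.2.trans_lt hδT⟩
    · intro s hs
      have hbs : b < s := by
        by_contra! h
        exact hs.2 ⟨hs.1.1, h⟩
      rw [hηd0 s hbs]
      simp [hη, hθ0 s hbs.le]
  have hQint : ∫ s in (0 : ℝ)..b, -deriv θ s * Q s ≤ A t₁ + e := by
    calc ∫ s in (0 : ℝ)..b, -deriv θ s * Q s ≤ ∫ s in (0 : ℝ)..b, -deriv θ s * (A t₁ + e) := by
          refine intervalIntegral.integral_mono_on hb0.le
            (hθQc.intervalIntegrable_of_Icc hb0.le)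
            (Continuous.intervalIntegrable (by fun_prop) _ _) fun s hs => ?_
          rcases lt_or_ge s t₁ with h | h
          · simp [hθ'0 s h]
          · exact mul_le_mul_of_nonneg_left (hQle s ⟨h, hs.2⟩) (by linarith [hθ' s])
      _ = A t₁ + e := by
          rw [intervalIntegral.integral_mul_const, intervalIntegral.integral_neg,
            intervalIntegral.integral_deriv_eq_sub (fun x _ => hθd x)
            (hθ'c.intervalIntegrable _ _), hθ0 b le_rfl, hθ1 0 ht₁.1]
          ring
  -- The source between `t₁` and `b` is dropped by sign; hence an inequality.
  have hHint : ∫ s in Ioc 0 t₁, Real.cosh (k * (t₁ - s)) * H s ≤ ∫ t in Ioo 0 T, η t * H t := by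
    have hcongr : ∫ s in Ioc 0 t₁, Real.cosh (k * (t₁ - s)) * H s = ∫ s in Ioc 0 t₁, η s * H s :=
      setIntegral_congr_fun measurableSet_Ioc fun s hs => by
        simp only [hηeq s (by linarith [hs.1]), hθ1 s hs.2, one_mul]
    rw [hcongr]
    refine setIntegral_mono_set ?_ ?_ ?_
    · obtain ⟨M, hM⟩ := (HasCompactSupport.intro' isCompact_Icc isClosed_Icc
        fun x hx => Function.notMem_support.1 fun h => hx (hηsupp h)).exists_bound_of_continuous
          hηs.continuous
      exact hH.bdd_mul hηs.continuous.aestronglyMeasurable (Filter.Eventually.of_forall hM)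
    · filter_upwards [hH0] with s hs
      refine mul_nonneg ?_ hs
      exact mul_nonneg (mul_nonneg (Real.smoothTransition.nonneg _) (Real.cosh_pos _).le)
        (Real.smoothTransition.nonneg _)
    · exact (show Ioc 0 t₁ ⊆ Ioo 0 T from fun x hx => ⟨hx.1, hx.2.trans_lt ht₁.2⟩).eventuallyLE
  rw [hrhs, hRint] at hw
  linarith

/-- Both hyperbolic functions are split into exponentials and only the growing ones are kept. The
decaying data term has coefficient `(A₀ - k B 0) / 2`, which is why its sign is assumed. -/
lemma exp_weighted_duhamel_le {T k A₀ : ℝ} {A B H : ℝ → ℝ} (hA : ContinuousOn A (Ico 0 T))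
    (hB : ∀ t ∈ Ico 0 T, HasDerivWithinAt B (A t) (Ico 0 T) t)
    (hH : IntegrableOn H (Ioo 0 T)) (hH0 : ∀ᵐ t ∂volume.restrict (Ioo 0 T), 0 ≤ H t)
    (hweak : ∀ η : ℝ → ℝ, ContDiff ℝ ∞ η → HasCompactSupport η → tsupport η ⊆ Iio T →
      A₀ * η 0 + ∫ t in Ioo 0 T, η t * H t
        = ∫ t in Ioo 0 T, (-(deriv η t * A t) - k ^ 2 * (η t * B t)))
    (hdata : 0 ≤ A₀ - k * B 0) {t : ℝ} (ht : t ∈ Ico 0 T) :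
    (A₀ + k * B 0) / 2 + (1 / 2) * ∫ s in Ioc 0 t, Real.exp (-(k * s)) * H s
      ≤ Real.exp (-(k * t)) * A t := by
  have h := cosh_duhamel_le hA hB hH hH0 hweak ht
  have hsub : Ioc 0 t ⊆ Ioo 0 T := fun x hx => ⟨hx.1, hx.2.trans_lt ht.2⟩
  have hbdd : ∀ f : ℝ → ℝ, Continuous f → IntegrableOn (fun s => f s * H s) (Ioc 0 t) := by
    intro f hf
    obtain ⟨M, hM⟩ := (isCompact_Icc (a := 0) (b := t)).exists_bound_of_continuousOn
      hf.continuousOn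
    refine (hH.mono_set hsub).bdd_mul hf.aestronglyMeasurable (c := M) ?_
    filter_upwards [ae_restrict_mem measurableSet_Ioc] with s hs using hM s ⟨hs.1.le, hs.2⟩
  have hint : Real.exp (k * t) * ((1 / 2) * ∫ s in Ioc 0 t, Real.exp (-(k * s)) * H s)
      ≤ ∫ s in Ioc 0 t, Real.cosh (k * (t - s)) * H s := by
    rw [← integral_const_mul, ← integral_const_mul]
    refine integral_mono_ae (((hbdd _ (by fun_prop)).const_mul _).const_mul _)
      (hbdd _ (by fun_prop)) ?_
    filter_upwards [ae_restrict_of_ae_restrict_of_subset hsub hH0] with s hs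
    have h1 : Real.exp (k * t) * Real.exp (-(k * s)) = Real.exp (k * (t - s)) := by
      rw [← Real.exp_add]; ring_nf
    have h2 : Real.exp (k * (t - s)) / 2 ≤ Real.cosh (k * (t - s)) := by
      rw [Real.cosh_eq]
      linarith [Real.exp_pos (-(k * (t - s)))]
    calc Real.exp (k * t) * (1 / 2 * (Real.exp (-(k * s)) * H s))
        = Real.exp (k * (t - s)) / 2 * H s := by rw [← h1]; ring
      _ ≤ _ := mul_le_mul_of_nonneg_right h2 hs
  have hdat : Real.exp (k * t) * ((A₀ + k * B 0) / 2)
      ≤ A₀ * Real.cosh (k * t) + k * B 0 * Real.sinh (k * t) := by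
    rw [Real.cosh_eq, Real.sinh_eq]
    nlinarith [mul_nonneg hdata (Real.exp_pos (-(k * t))).le]
  have hE : Real.exp (-(k * t)) * Real.exp (k * t) = 1 := by
    rw [← Real.exp_add]; simp
  have hsum : Real.exp (k * t) * ((A₀ + k * B 0) / 2
      + (1 / 2) * ∫ s in Ioc 0 t, Real.exp (-(k * s)) * H s) ≤ A t := by linarith
  have := mul_le_mul_of_nonneg_left hsum (Real.exp_pos (-(k * t))).le
  rwa [← mul_assoc, hE, one_mul] at this

/-! ### Mass of a plane wave on a ball -/

/-- Majorant, in product form, of `exp (k (x i₀ - R))` on the ball of radius `R`. -/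
noncomputable def planeMajorant {N : ℕ} (k R : ℝ) (i₀ i : Fin N) : ℝ → ℝ :=
  if i = i₀ then (Iic R).indicator (fun s => Real.exp (-(k / 2 * R)) * Real.exp (k / 2 * s))
  else fun s => Real.exp (-(k / (4 * R)) * s ^ 2)

lemma integrable_planeMajorant {N : ℕ} {k R : ℝ} (hk : 0 < k) (hR : 0 < R) (i₀ i : Fin N) :
    Integrable (planeMajorant k R i₀ i) := by
  unfold planeMajorant
  split_ifs with h
  · rw [integrable_indicator_iff measurableSet_Iic]
    exact (integrableOn_exp_mul_Iic (by positivity) R).const_mul _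
  · exact integrable_exp_neg_mul_sq (by positivity)

lemma integral_prod_planeMajorant {N : ℕ} {k R : ℝ} (hk : 0 < k) (hR : 0 < R) (i₀ : Fin N) :
    ∏ i, ∫ s, planeMajorant k R i₀ i s
      = 2 / k * Real.sqrt (4 * Real.pi / k) ^ (N - 1) * R ^ (((N : ℝ) - 1) / 2) := by
  have h0 : ∫ s, planeMajorant k R i₀ i₀ s = 2 / k := by
    simp only [planeMajorant, if_pos]
    rw [integral_indicator measurableSet_Iic, integral_const_mul,
      integral_exp_mul_Iic (by positivity), ← mul_div_assoc, ← Real.exp_add]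
    simp
  have h1 : ∀ i ∈ Finset.univ.erase i₀, ∫ s, planeMajorant k R i₀ i s
      = Real.sqrt (4 * Real.pi / k) * Real.sqrt R := by
    intro i hi
    simp only [planeMajorant, if_neg (Finset.ne_of_mem_erase hi)]
    rw [integral_gaussian, ← Real.sqrt_mul (by positivity)]
    congr 1
    field_simp
  have hN : 1 ≤ N := by have := i₀.2; omega
  rw [← Finset.mul_prod_erase _ _ (Finset.mem_univ i₀), h0, Finset.prod_congr rfl h1,
    Finset.prod_const, Finset.card_erase_of_mem (Finset.mem_univ _), Finset.card_univ,
    Fintype.card_fin, mul_pow, mul_assoc]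
  congr 2
  rw [Real.sqrt_eq_rpow, ← Real.rpow_natCast, ← Real.rpow_mul hR.le, Nat.cast_sub hN]
  congr 1
  push_cast
  ring

/-- Write `S` for the squared length of the components other than `x i₀`. In the ball, `S ≤ R² - (x
i₀)² ≤ 2R (R - x i₀)`. Half of the decay in `R - x i₀` is thus traded for a Gaussian of width `√R`
in each transverse variable, and the majorant factorizes for Fubini; the `N - 1` Gaussians produce
`R^((N-1)/2)`. -/
lemma exp_le_prod_planeMajorant {N : ℕ} {k R : ℝ} (hk : 0 < k) (hR : 0 < R) (i₀ : Fin N)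
    {x : Space N} (hx : ‖x‖ ≤ R) :
    Real.exp (k * x i₀) ≤ Real.exp (k * R) * ∏ i, planeMajorant k R i₀ i (x i) := by
  have hsq : x i₀ ^ 2 + ∑ i ∈ Finset.univ.erase i₀, x i ^ 2 ≤ R ^ 2 := by
    rw [Finset.add_sum_erase _ (fun i => x i ^ 2) (Finset.mem_univ i₀)]
    have h1 : ‖x‖ ^ 2 = ∑ i, x i ^ 2 := by
      rw [EuclideanSpace.norm_sq_eq]
      simp
    rw [← h1]
    exact pow_le_pow_left₀ (norm_nonneg _) hx 2
  set S := ∑ i ∈ Finset.univ.erase i₀, x i ^ 2 with hS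
  have hS0 : 0 ≤ S := Finset.sum_nonneg fun i _ => sq_nonneg _
  have hx0 : x i₀ ≤ R := (abs_le_of_sq_le_sq' (by linarith) hR.le).2
  have h0 : planeMajorant k R i₀ i₀ (x i₀)
      = Real.exp (-(k / 2 * R)) * Real.exp (k / 2 * x i₀) := by
    simp only [planeMajorant, if_pos]
    rw [indicator_of_mem (by exact hx0)]
  have h1 : ∏ i ∈ Finset.univ.erase i₀, planeMajorant k R i₀ i (x i)
      = Real.exp (-(k / (4 * R)) * S) := by
    rw [hS, Finset.mul_sum, Real.exp_sum]
    refine Finset.prod_congr rfl fun i hi => ?_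
    simp only [planeMajorant, if_neg (Finset.ne_of_mem_erase hi)]
  rw [← Finset.mul_prod_erase _ _ (Finset.mem_univ i₀), h0, h1, ← Real.exp_add, ← Real.exp_add,
    ← Real.exp_add, Real.exp_le_exp]
  have h2 : S ≤ 2 * R * (R - x i₀) := by nlinarith [sq_nonneg (R - x i₀)]
  have h3 : k / (4 * R) * S ≤ k / (4 * R) * (2 * R * (R - x i₀)) := by gcongr
  have h4 : k / (4 * R) * (2 * R * (R - x i₀)) = k / 2 * (R - x i₀) := by field_simp; ring
  rw [h4] at h3
  linarith

/-- The mass of a plane wave `exp (k x·e)` on the ball of radius `R` is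
`O(R^{(N-1)/2} exp (k R))`. -/
theorem setIntegral_exp_closedBall_le {N : ℕ} {k R : ℝ} (hk : 0 < k) (hR : 0 < R) (i₀ : Fin N) :
    ∫ x in Metric.closedBall (0 : Space N) R, Real.exp (k * x i₀)
      ≤ Real.exp (k * R) *
        (2 / k * Real.sqrt (4 * Real.pi / k) ^ (N - 1) * R ^ (((N : ℝ) - 1) / 2)) := by
  have hmp := EuclideanSpace.volume_preserving_symm_measurableEquiv_toLp (Fin N)
  have hint : Integrable (fun x : Space N => ∏ i, planeMajorant k R i₀ i (x i)) :=
    hmp.integrable_comp_of_integrable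
      (Integrable.fintype_prod fun i => integrable_planeMajorant hk hR i₀ i)
  have hnn : ∀ x : Space N, 0 ≤ ∏ i, planeMajorant k R i₀ i (x i) := fun x =>
    Finset.prod_nonneg fun i _ => by
      unfold planeMajorant
      split_ifs
      · exact indicator_nonneg (fun s _ => by positivity) _
      · positivity
  have heq : ∫ x : Space N, ∏ i, planeMajorant k R i₀ i (x i)
      = ∏ i, ∫ s, planeMajorant k R i₀ i s := by
    rw [← integral_fintype_prod_volume_eq_prod]
    exact hmp.integral_comp (MeasurableEquiv.measurableEmbedding _)
      (fun y : Fin N → ℝ => ∏ i, planeMajorant k R i₀ i (y i))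
  rw [← integral_prod_planeMajorant hk hR i₀, ← heq, ← integral_const_mul]
  refine le_trans (setIntegral_mono_on ?_ (hint.const_mul _).integrableOn
    measurableSet_closedBall fun x hx =>
      exp_le_prod_planeMajorant hk hR i₀ (by simpa using hx)) ?_
  · exact (Continuous.continuousOn (by fun_prop)).integrableOn_compact
      (isCompact_closedBall _ _)
  · exact setIntegral_le_integral (hint.const_mul _)
      (Filter.Eventually.of_forall fun x => mul_nonneg (Real.exp_pos _).le (hnn x))

/-! ### Jensen's inequality -/

/-- The tangent line of `y ↦ y^p` at `K`. -/
lemma tangent_line_le_rpow {p K y : ℝ} (hp : 1 ≤ p) (hK : 0 < K) (hy : 0 ≤ y) :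
    K ^ p + p * K ^ (p - 1) * (y - K) ≤ y ^ p := by
  have h := one_add_mul_self_le_rpow_one_add (s := y / K - 1)
    (by have : 0 ≤ y / K := by positivity
        linarith) hp
  rw [add_sub_cancel, Real.div_rpow hy hK.le, le_div_iff₀ (by positivity)] at h
  refine le_trans (le_of_eq ?_) h
  have : K ^ p = K ^ (p - 1) * K := by rw [← Real.rpow_add_one hK.ne', sub_add_cancel]
  rw [this]
  field_simp

/-- Jensen's inequality for the weight `m` on a set `S` off which `f` vanishes. -/
lemma rpow_abs_integral_le {E : Type*} [MeasurableSpace E] {μ : Measure E} {f m : E → ℝ}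
    {S : Set E} {p W : ℝ} (hp : 1 < p) (hS : MeasurableSet S) (hm0 : ∀ x, 0 ≤ m x)
    (hf : ∀ᵐ x ∂μ, x ∉ S → f x = 0)
    (hmS : IntegrableOn m S μ) (hfm : Integrable (fun x => f x * m x) μ)
    (hfpm : Integrable (fun x => |f x| ^ p * m x) μ) (hW : 0 < W) (hmW : ∫ x in S, m x ∂μ ≤ W) :
    |∫ x, f x * m x ∂μ| ^ p * W ^ (-(p - 1)) ≤ ∫ x, |f x| ^ p * m x ∂μ := by
  set I := |∫ x, f x * m x ∂μ| with hI
  have hI0 : 0 ≤ I := abs_nonneg _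
  have hIle : I ≤ ∫ x, |f x| * m x ∂μ := by
    refine (abs_integral_le_integral_abs).trans (le_of_eq ?_)
    congr 1
    ext x
    rw [abs_mul, abs_of_nonneg (hm0 x)]
  have habs : Integrable (fun x => |f x| * m x) μ := by
    refine hfm.abs.congr (Filter.Eventually.of_forall fun x => ?_)
    simp only [abs_mul, abs_of_nonneg (hm0 x)]
  rcases hI0.eq_or_lt with h0 | hIpos
  · rw [← h0, Real.zero_rpow (by linarith), zero_mul]
    exact integral_nonneg fun x => mul_nonneg (by positivity) (hm0 x)
  -- The tangent point is the mean for the upper bound `W` of the mass, which makes the final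
  -- expression exactly `I^p W^(-(p-1))`.
  set K := I / W with hK
  have hK0 : 0 < K := by positivity
  have hmS' : Integrable (S.indicator m) μ := (integrable_indicator_iff hS).2 hmS
  have hle : ∫ x, (p * K ^ (p - 1) * (|f x| * m x) - (p - 1) * K ^ p * S.indicator m x) ∂μ
      ≤ ∫ x, |f x| ^ p * m x ∂μ := by
    refine integral_mono_ae ((habs.const_mul _).sub (hmS'.const_mul _)) hfpm ?_
    filter_upwards [hf] with x hx
    by_cases hxS : x ∈ S
    · rw [indicator_of_mem hxS]
      have h1 := tangent_line_le_rpow hp.le hK0 (abs_nonneg (f x))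
      have h2 : K ^ p = K ^ (p - 1) * K := by rw [← Real.rpow_add_one hK0.ne', sub_add_cancel]
      have h3 := mul_le_mul_of_nonneg_right h1 (hm0 x)
      have h4 : (K ^ p + p * K ^ (p - 1) * (|f x| - K)) * m x
          = p * K ^ (p - 1) * (|f x| * m x) - (p - 1) * K ^ p * m x := by rw [h2]; ring
      linarith
    · rw [indicator_of_notMem hxS, hx hxS]
      simp [Real.zero_rpow (show p ≠ 0 by linarith)]
  rw [integral_sub (habs.const_mul _) (hmS'.const_mul _), integral_const_mul, integral_const_mul,
    integral_indicator hS] at hle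
  refine le_trans ?_ hle
  have h5 : p * K ^ (p - 1) * I ≤ p * K ^ (p - 1) * ∫ x, |f x| * m x ∂μ := by gcongr
  have h6 : (p - 1) * K ^ p * ∫ x in S, m x ∂μ ≤ (p - 1) * K ^ p * W := by
    have : 0 ≤ p - 1 := by linarith
    gcongr
  have h7 : p * K ^ (p - 1) * I - (p - 1) * K ^ p * W = I ^ p * W ^ (-(p - 1)) := by
    have h2 : K ^ p = K ^ (p - 1) * K := by rw [← Real.rpow_add_one hK0.ne', sub_add_cancel]
    have h8 : I ^ p = I ^ (p - 1) * I := by rw [← Real.rpow_add_one hIpos.ne', sub_add_cancel]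
    rw [h2, h8, hK, Real.div_rpow hI0 hW.le, Real.rpow_neg hW.le]
    have : W ^ (p - 1) ≠ 0 := by positivity
    field_simp
    ring
  linarith

/-! ### Truncated plane waves and weak gradients -/

/-- `m` is a smooth compactly supported truncation of the plane wave `exp (k x·e)`, equal to it on
the ball of radius `R`. -/
structure IsTruncatedPlaneWave {N : ℕ} (k R : ℝ) (i₀ : Fin N) (m : Space N → ℝ) : Prop where
  contDiff : ContDiff ℝ ∞ m
  hasCompactSupport : HasCompactSupport m
  nonneg : ∀ x, 0 ≤ m x
  le_exp : ∀ x, m x ≤ Real.exp (k * x i₀)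
  eq_exp : ∀ x, ‖x‖ < R → m x = Real.exp (k * x i₀)

lemma exists_isTruncatedPlaneWave {N : ℕ} (k : ℝ) {R : ℝ} (hR : 0 < R) (i₀ : Fin N) :
    ∃ m : Space N → ℝ, IsTruncatedPlaneWave k R i₀ m := by
  let χ : ContDiffBump (0 : Space N) := ⟨R, R + 1, hR, by linarith⟩
  have hexp : ContDiff ℝ ∞ (fun x : Space N => Real.exp (k * x i₀)) :=
    Real.contDiff_exp.comp (contDiff_const.mul
      (EuclideanSpace.proj (𝕜 := ℝ) i₀ : Space N →L[ℝ] ℝ).contDiff)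
  refine ⟨fun x => Real.exp (k * x i₀) * χ x, hexp.mul χ.contDiff,
    χ.hasCompactSupport.mul_left, fun x => mul_nonneg (Real.exp_pos _).le χ.nonneg,
    fun x => mul_le_of_le_one_right (Real.exp_pos _).le χ.le_one, fun x hx => ?_⟩
  have : χ x = 1 := χ.one_of_mem_closedBall (by simpa using hx.le)
  simp [this]

/-- The partial derivative of `m` in the direction of the `i`-th coordinate. -/
noncomputable def partialDeriv {N : ℕ} (i : Fin N) (m : Space N → ℝ) (x : Space N) : ℝ :=
  fderiv ℝ m x (EuclideanSpace.single i 1)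

lemma contDiff_partialDeriv {N : ℕ} {m : Space N → ℝ} (hm : ContDiff ℝ ∞ m) (i : Fin N) :
    ContDiff ℝ ∞ (partialDeriv i m) :=
  (hm.fderiv_right (m := ∞) le_rfl).clm_apply contDiff_const

lemma hasCompactSupport_partialDeriv {N : ℕ} {m : Space N → ℝ} (hm : HasCompactSupport m)
    (i : Fin N) : HasCompactSupport (partialDeriv i m) :=
  hm.fderiv_apply ℝ _

lemma gradient_apply {N : ℕ} (m : Space N → ℝ) (x : Space N) (i : Fin N) :
    gradient m x i = partialDeriv i m x := by
  rw [partialDeriv, ← inner_gradient_left, EuclideanSpace.inner_single_right]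
  simp

lemma IsTruncatedPlaneWave.partialDeriv_eq {N : ℕ} {k R : ℝ} {i₀ : Fin N} {m : Space N → ℝ}
    (hm : IsTruncatedPlaneWave k R i₀ m) (i : Fin N) {x : Space N} (hx : ‖x‖ < R) :
    partialDeriv i m x = (if i = i₀ then k else 0) * m x := by
  have h1 : m =ᶠ[nhds x] fun y => Real.exp (k * y i₀) := by
    filter_upwards [(isOpen_lt continuous_norm continuous_const).mem_nhds hx] with y hy
    exact hm.eq_exp y hy
  have h2 : HasFDerivAt (fun y : Space N => Real.exp (k * y i₀))
      (Real.exp (k * x i₀) • (k • (EuclideanSpace.proj (𝕜 := ℝ) i₀ : Space N →L[ℝ] ℝ))) x :=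
    (((EuclideanSpace.proj (𝕜 := ℝ) i₀ : Space N →L[ℝ] ℝ).hasFDerivAt).const_mul k).exp
  rw [partialDeriv, h1.fderiv_eq, h2.fderiv, hm.eq_exp x hx]
  by_cases h : i = i₀
  · simp [h, mul_comm]
  · simp [h, Ne.symm h]

lemma IsTruncatedPlaneWave.partialDeriv_partialDeriv_eq {N : ℕ} {k R : ℝ} {i₀ : Fin N}
    {m : Space N → ℝ} (hm : IsTruncatedPlaneWave k R i₀ m) (i : Fin N) {x : Space N}
    (hx : ‖x‖ < R) :
    partialDeriv i (partialDeriv i m) x = (if i = i₀ then k ^ 2 else 0) * m x := by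
  have h1 : partialDeriv i m =ᶠ[nhds x] fun y => (if i = i₀ then k else 0) * m y := by
    filter_upwards [(isOpen_lt continuous_norm continuous_const).mem_nhds hx] with y hy
    exact hm.partialDeriv_eq i hy
  have hd : DifferentiableAt ℝ m x := (hm.contDiff.differentiable (by simp)) x
  rw [partialDeriv, h1.fderiv_eq, fderiv_const_mul hd, smul_apply, smul_eq_mul]
  change _ * partialDeriv i m x = _
  rw [hm.partialDeriv_eq i hx]
  split_ifs <;> ring

lemma inner_gradient_eq_sum {N : ℕ} (m : Space N → ℝ) (x y : Space N) :
    inner ℝ y (gradient m x) = ∑ i, partialDeriv i m x * y i := by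
  rw [PiLp.inner_apply]
  refine Finset.sum_congr rfl fun i _ => ?_
  rw [gradient_apply]
  simp

lemma integrable_partialDeriv_mul {N : ℕ} (F : Lp (Space N) 2 (volume : Measure (Space N)))
    {m : Space N → ℝ} (hm : ContDiff ℝ ∞ m) (hc : HasCompactSupport m) (i : Fin N) :
    Integrable (fun x => partialDeriv i m x * F x i) := by
  have := (EuclideanSpace.proj (𝕜 := ℝ) i : Space N →L[ℝ] ℝ).integrable_comp
    (integrable_smul_field F (contDiff_partialDeriv hm i) (hasCompactSupport_partialDeriv hc i))
  simpa using this

lemma integrable_inner_gradient {N : ℕ} (F : Lp (Space N) 2 (volume : Measure (Space N)))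
    {m : Space N → ℝ} (hm : ContDiff ℝ ∞ m) (hc : HasCompactSupport m) :
    Integrable (fun x => inner ℝ (F x) (gradient m x)) := by
  simp only [inner_gradient_eq_sum]
  exact integrable_finsetSum _ fun i _ => integrable_partialDeriv_mul F hm hc i

lemma IsWeakGradient.integral_partialDeriv {N : ℕ} {w : Lp ℝ 2 (volume : Measure (Space N))}
    {F : Lp (Space N) 2 (volume : Measure (Space N))} (h : IsWeakGradient w F)
    {φ : Space N → ℝ} (hφ : ContDiff ℝ ∞ φ) (hc : HasCompactSupport φ) (i : Fin N) :
    ∫ x, w x * partialDeriv i φ x = - ∫ x, φ x * F x i := by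
  have h1 := congrArg (EuclideanSpace.proj (𝕜 := ℝ) i : Space N →L[ℝ] ℝ) (h φ hφ hc)
  rw [map_neg, ← ContinuousLinearMap.integral_comp_comm _ (integrable_smul_gradient w hφ hc),
    ← ContinuousLinearMap.integral_comp_comm _ (integrable_smul_field F hφ hc)] at h1
  simpa [gradient_apply] using h1

/-- Testing the weak gradient of `w`, supported in the ball of radius `R`, against a truncated
plane wave. -/
lemma IsWeakGradient.integral_inner_planeWave {N : ℕ} {k R : ℝ} {i₀ : Fin N} {m : Space N → ℝ}
    (hm : IsTruncatedPlaneWave k R i₀ m) {w : Lp ℝ 2 (volume : Measure (Space N))}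
    {F : Lp (Space N) 2 (volume : Measure (Space N))} (h : IsWeakGradient w F)
    (hw : ∀ᵐ x, R ≤ ‖x‖ → w x = 0) :
    ∫ x, inner ℝ (F x) (gradient m x) = -(k ^ 2 * ∫ x, w x * m x) := by
  have hi : ∀ i, ∫ x, partialDeriv i m x * F x i
      = if i = i₀ then -(k ^ 2 * ∫ x, w x * m x) else 0 := by
    intro i
    have h1 := h.integral_partialDeriv (contDiff_partialDeriv hm.contDiff i)
      (hasCompactSupport_partialDeriv hm.hasCompactSupport i) i
    have h2 : ∫ x, w x * partialDeriv i (partialDeriv i m) x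
        = (if i = i₀ then k ^ 2 else 0) * ∫ x, w x * m x := by
      rw [← integral_const_mul]
      refine integral_congr_ae ?_
      filter_upwards [hw] with x hx
      rcases lt_or_ge ‖x‖ R with hlt | hge
      · rw [hm.partialDeriv_partialDeriv_eq i hlt]
        ring
      · simp [hx hge]
    rw [← neg_eq_iff_eq_neg.2 h1, h2]
    split_ifs <;> ring
  simp only [inner_gradient_eq_sum]
  rw [integral_finsetSum _ fun i _ =>
    integrable_partialDeriv_mul F hm.contDiff hm.hasCompactSupport i]
  simp [hi]

/-! ### Moments of curves in the energy class -/

/-- The functional `w ↦ ∫ w m` on `L²`, for a test function `m`. -/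
noncomputable def pairing {N : ℕ} {m : Space N → ℝ} (hm : ContDiff ℝ ∞ m)
    (hc : HasCompactSupport m) : Lp ℝ 2 (volume : Measure (Space N)) →L[ℝ] ℝ :=
  innerSL ℝ ((hm.continuous.memLp_of_hasCompactSupport hc : MemLp m 2 volume).toLp m)

lemma pairing_apply {N : ℕ} {m : Space N → ℝ} (hm : ContDiff ℝ ∞ m)
    (hc : HasCompactSupport m) (w : Lp ℝ 2 (volume : Measure (Space N))) :
    pairing hm hc w = ∫ x, w x * m x := by
  rw [pairing, innerSL_apply_apply, L2.inner_def]
  refine integral_congr_ae ?_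
  filter_upwards [(hm.continuous.memLp_of_hasCompactSupport hc :
    MemLp m 2 volume).coeFn_toLp] with x hx
  rw [hx]
  simp

lemma integrable_mul_of_L2 {N : ℕ} {m : Space N → ℝ} (hm : ContDiff ℝ ∞ m)
    (hc : HasCompactSupport m) (w : Lp ℝ 2 (volume : Measure (Space N))) :
    Integrable (fun x => w x * m x) :=
  (Lp.memLp w).integrable_mul (hm.continuous.memLp_of_hasCompactSupport hc : MemLp m 2 volume)

section Time

variable {N : ℕ} {T : ℝ} {u : ℝ → H1 N}

lemma IsEnergyClass.hasDerivWithinAt (hu : IsEnergyClass T u) {t : ℝ} (ht : t ∈ Ico 0 T) :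
    HasDerivWithinAt (fun s => valH1 (u s)) (timeDeriv T u t) (Ico 0 T) t :=
  ((hu.2.differentiableOn (by simp)) t ht).hasDerivWithinAt

lemma IsEnergyClass.continuousOn_timeDeriv (hu : IsEnergyClass T u) :
    ContinuousOn (timeDeriv T u) (Ico 0 T) :=
  hu.2.continuousOn_derivWithin (uniqueDiffOn_Ico 0 T) le_rfl

lemma IsEnergyClass.hasDerivWithinAt_pairing (hu : IsEnergyClass T u) {m : Space N → ℝ}
    (hm : ContDiff ℝ ∞ m) (hc : HasCompactSupport m) {t : ℝ} (ht : t ∈ Ico 0 T) :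
    HasDerivWithinAt (fun s => ∫ x, valH1 (u s) x * m x) (∫ x, timeDeriv T u t x * m x)
      (Ico 0 T) t := by
  simp only [← pairing_apply hm hc]
  exact (pairing hm hc).hasFDerivAt.comp_hasDerivWithinAt t (hu.hasDerivWithinAt ht)

lemma IsEnergyClass.continuousOn_pairing (hu : IsEnergyClass T u) {m : Space N → ℝ}
    (hm : ContDiff ℝ ∞ m) (hc : HasCompactSupport m) :
    ContinuousOn (fun s => ∫ x, timeDeriv T u s x * m x) (Ico 0 T) := by
  simp only [← pairing_apply hm hc]
  exact (pairing hm hc).continuous.comp_continuousOn hu.continuousOn_timeDeriv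

/-- The time derivative vanishes outside of the cone as well. -/
lemma SupportedInCone.timeDeriv {r : ℝ} (hs : SupportedInCone r T u) (hu : IsEnergyClass T u)
    {t : ℝ} (ht : t ∈ Ico 0 T) :
    ∀ᵐ x ∂(volume : Measure (Space N)), r + t < ‖x‖ → timeDeriv T u t x = 0 := by
  -- Restricted to `|x| > ρ`, the curve is zero on a relative neighbourhood of `t`, hence so is its
  -- derivative.
  have key : ∀ ρ, r + t < ρ → ∀ᵐ x ∂(volume : Measure (Space N)),
      ρ < ‖x‖ → WaveSystem.timeDeriv T u t x = 0 := by
    intro ρ hρ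
    set S : Set (Space N) := {x | ρ < ‖x‖} with hS
    have hSm : MeasurableSet S := (isOpen_lt continuous_const continuous_norm).measurableSet
    set Λ := LpToLpRestrictCLM (Space N) ℝ ℝ volume 2 S
    have h1 : HasDerivWithinAt (fun s => Λ (valH1 (u s))) (Λ (WaveSystem.timeDeriv T u t))
        (Ico 0 T) t :=
      Λ.hasFDerivAt.comp_hasDerivWithinAt t (hu.hasDerivWithinAt ht)
    have hzero : ∀ s ∈ Ico 0 T, r + s < ρ → Λ (valH1 (u s)) = 0 := by
      intro s hsT hsρ
      rw [Lp.eq_zero_iff_ae_eq_zero]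
      filter_upwards [LpToLpRestrictCLM_coeFn ℝ S (valH1 (u s)),
        ae_restrict_of_ae (hs s hsT), ae_restrict_mem hSm] with x h2 h3 h4
      rw [h2]
      exact h3 (hsρ.trans h4)
    have h2 : HasDerivWithinAt (fun s => Λ (valH1 (u s))) 0 (Ico 0 T) t := by
      refine (hasDerivWithinAt_const t (Ico 0 T)
        (0 : Lp ℝ 2 (volume.restrict S))).congr_of_eventuallyEq ?_ (hzero t ht hρ)
      filter_upwards [self_mem_nhdsWithin,
        mem_nhdsWithin_of_mem_nhds (Iio_mem_nhds (show t < ρ - r by linarith))] with s h3 h4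
      exact hzero s h3 (by rw [mem_Iio] at h4; linarith)
    have h3 := (uniqueDiffOn_Ico 0 T t ht).eq_deriv _ h1 h2
    rw [Lp.eq_zero_iff_ae_eq_zero] at h3
    have h4 := (LpToLpRestrictCLM_coeFn ℝ S (WaveSystem.timeDeriv T u t)).symm.trans h3
    rw [Filter.EventuallyEq, ae_restrict_iff' hSm] at h4
    exact h4
  -- Countably many radii decreasing to `r + t` keep the exceptional set null.
  have hall : ∀ᵐ x ∂(volume : Measure (Space N)), ∀ n : ℕ,
      r + t + 1 / ((n : ℝ) + 1) < ‖x‖ → WaveSystem.timeDeriv T u t x = 0 :=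
    ae_all_iff.2 fun n => key _ (by
      have : 0 < 1 / ((n : ℝ) + 1) := by positivity
      linarith)
  filter_upwards [hall] with x hx hlt
  obtain ⟨n, hn⟩ := exists_nat_one_div_lt (show 0 < ‖x‖ - (r + t) by linarith)
  exact hx n (by linarith)

/-- Pairing with the bounded function `m` is a continuous functional on `L¹`, so measurability and
integrability in time pass from the Bochner representative. -/
lemma MemL1L1.integrableOn_pairing {h : ℝ → Space N → ℝ} (hh : MemL1L1 T h)
    {m : Space N → ℝ} (hm : ContDiff ℝ ∞ m) (hc : HasCompactSupport m) :
    IntegrableOn (fun t => ∫ x, h t x * m x) (Ioo 0 T) := by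
  obtain ⟨κ, hκ, heq⟩ := hh
  have hmt := hm.continuous.memLp_top_of_hasCompactSupport hc (volume : Measure (Space N))
  set Λ := (ContinuousLinearMap.lpPairing (volume : Measure (Space N)) 1 ⊤
    (ContinuousLinearMap.mul ℝ ℝ)).flip (hmt.toLp m)
  refine (Λ.integrable_comp hκ).congr ?_
  filter_upwards [heq] with t ht
  rw [ContinuousLinearMap.flip_apply, ContinuousLinearMap.lpPairing_eq_integral]
  refine integral_congr_ae ?_
  filter_upwards [ht, hmt.coeFn_toLp] with x h1 h2
  simp [h1, h2]

lemma MemL1L1.ae_integrable {h : ℝ → Space N → ℝ} (hh : MemL1L1 T h) :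
    ∀ᵐ t ∂(volume.restrict (Ioo 0 T)), Integrable (h t) := by
  obtain ⟨κ, -, heq⟩ := hh
  filter_upwards [heq] with t ht
  exact (L1.integrable_coeFn (κ t)).congr ht

/-- The scalar weak equation satisfied by the moments of a weak solution against a truncated plane
wave. -/
lemma WeakWaveEquation.moment {h : ℝ → Space N → ℝ} {u₁ : Space N → ℝ}
    (hweak : WeakWaveEquation T u h u₁) {k R r : ℝ} {i₀ : Fin N} {m : Space N → ℝ}
    (hm : IsTruncatedPlaneWave k R i₀ m) (hR : r + T < R) (hs : SupportedInCone r T u)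
    {η : ℝ → ℝ} (hη : ContDiff ℝ ∞ η) (hηc : HasCompactSupport η) (hηT : tsupport η ⊆ Iio T) :
    (∫ x, u₁ x * m x) * η 0 + ∫ t in Ioo 0 T, η t * ∫ x, h t x * m x
      = ∫ t in Ioo 0 T, (-(deriv η t * ∫ x, timeDeriv T u t x * m x)
          - k ^ 2 * (η t * ∫ x, valH1 (u t) x * m x)) := by
  have hmd : Differentiable ℝ m := hm.contDiff.differentiable (by simp)
  have hηd : Differentiable ℝ η := hη.differentiable (by simp)
  have hsub : Function.support (fun z : Space N × ℝ => η z.2 * m z.1)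
      ⊆ tsupport m ×ˢ tsupport η := by
    intro z hz
    exact ⟨subset_tsupport _ (right_ne_zero_of_mul hz), subset_tsupport _ (left_ne_zero_of_mul hz)⟩
  have hcl : IsClosed (tsupport m ×ˢ tsupport η) :=
    (isClosed_tsupport m).prod (isClosed_tsupport η)
  have htest : IsTestFunction T (fun z : Space N × ℝ => η z.2 * m z.1) := by
    refine ⟨(hη.comp contDiff_snd).mul (hm.contDiff.comp contDiff_fst), ?_, ?_⟩
    · exact HasCompactSupport.intro' (hm.hasCompactSupport.prod hηc) hcl
        fun x hx => Function.notMem_support.1 fun h => hx (hsub h)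
    · exact (closure_minimal hsub hcl).trans fun z hz => hηT hz.2
  have hw := hweak _ htest
  convert hw using 1
  · congr 1
    · rw [← integral_mul_const]
      congr 1; ext x; ring
    · congr 1; ext t
      rw [← integral_const_mul]
      congr 1; ext x; ring
  · refine setIntegral_congr_fun measurableSet_Ioo fun t ht => ?_
    have hsupp : ∀ᵐ x, R ≤ ‖x‖ → valH1 (u t) x = 0 := by
      filter_upwards [hs t ⟨ht.1.le, ht.2⟩] with x hx hRx
      exact hx (by linarith [ht.2])
    have hgrad := IsWeakGradient.integral_inner_planeWave hm
      (w := valH1 (u t)) (F := gradH1 (u t)) (u t).2 hsupp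
    have hpt : ∀ x, (-(timeDeriv T u t x * deriv (fun s => η s * m x) t)
        + inner ℝ (gradH1 (u t) x) (gradient (fun y => η t * m y) x))
        = -deriv η t * (timeDeriv T u t x * m x)
          + η t * inner ℝ (gradH1 (u t) x) (gradient m x) := by
      intro x
      have e1 : deriv (fun s => η s * m x) t = deriv η t * m x := deriv_mul_const (hηd t) _
      have e2 : gradient (fun y => η t * m y) x = η t • gradient m x := by
        rw [gradient, gradient, fderiv_const_mul (hmd x), map_smul]
      rw [e1, e2, inner_smul_right]
      ring
    simp only [hpt]
    rw [integral_add ((integrable_mul_of_L2 hm.contDiff hm.hasCompactSupport _).const_mul _)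
      ((integrable_inner_gradient _ hm.contDiff hm.hasCompactSupport).const_mul _),
      integral_const_mul, integral_const_mul, hgrad]
    ring

end Time

/-! ### Integral inequalities for the moments of a weak solution -/

/-- A constant `C` such that the plane wave `exp (k x·e)` has mass at most
`C exp (k s) (1+s)^{(N-1)/2}` on the ball of radius `ρ + s`. -/
noncomputable def planeMass (N : ℕ) (k ρ : ℝ) : ℝ :=
  Real.exp (k * ρ) * (2 / k * Real.sqrt (4 * Real.pi / k) ^ (N - 1)) * ρ ^ (((N : ℝ) - 1) / 2)

lemma planeMass_pos {N : ℕ} {k ρ : ℝ} (hk : 0 < k) (hρ : 0 < ρ) : 0 < planeMass N k ρ := by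
  unfold planeMass
  have : 0 < Real.sqrt (4 * Real.pi / k) := Real.sqrt_pos.2 (by positivity)
  positivity

lemma IsTruncatedPlaneWave.setIntegral_le {N : ℕ} {k R r ρ s : ℝ} {i₀ : Fin N}
    {m : Space N → ℝ} (hm : IsTruncatedPlaneWave k R i₀ m) (hk : 0 < k) (hρ : 1 ≤ ρ)
    (hr : r ≤ ρ) (hs : 0 ≤ s) :
    ∫ x in Metric.closedBall (0 : Space N) (r + s), m x
      ≤ planeMass N k ρ * Real.exp (k * s) * (1 + s) ^ (((N : ℝ) - 1) / 2) := by
  have hN : (1 : ℝ) ≤ N := by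
    have := i₀.2
    exact_mod_cast (by omega : 1 ≤ N)
  have hint : Integrable m := hm.contDiff.continuous.integrable_of_hasCompactSupport
    hm.hasCompactSupport
  have h1 : ∫ x in Metric.closedBall (0 : Space N) (r + s), m x
      ≤ ∫ x in Metric.closedBall (0 : Space N) (ρ + s), m x :=
    setIntegral_mono_set hint.integrableOn (Filter.Eventually.of_forall hm.nonneg)
      (Metric.closedBall_subset_closedBall (by linarith)).eventuallyLE
  have h2 : ∫ x in Metric.closedBall (0 : Space N) (ρ + s), m x
      ≤ ∫ x in Metric.closedBall (0 : Space N) (ρ + s), Real.exp (k * x i₀) :=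
    setIntegral_mono hint.integrableOn
      ((Continuous.continuousOn (by fun_prop)).integrableOn_compact (isCompact_closedBall _ _))
      hm.le_exp
  refine h1.trans (h2.trans ((setIntegral_exp_closedBall_le hk (by linarith) i₀).trans ?_))
  -- `ρ ≥ 1` gives `ρ + s ≤ ρ (1 + s)`.
  have h3 : (ρ + s) ^ (((N : ℝ) - 1) / 2)
      ≤ ρ ^ (((N : ℝ) - 1) / 2) * (1 + s) ^ (((N : ℝ) - 1) / 2) := by
    rw [← Real.mul_rpow (by linarith) (by linarith)]
    exact Real.rpow_le_rpow (by linarith) (by nlinarith) (by linarith)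
  calc _ ≤ Real.exp (k * (ρ + s)) * (2 / k * Real.sqrt (4 * Real.pi / k) ^ (N - 1) *
        (ρ ^ (((N : ℝ) - 1) / 2) * (1 + s) ^ (((N : ℝ) - 1) / 2))) := by gcongr
    _ = _ := by
      rw [planeMass, mul_add, Real.exp_add]
      ring

lemma DominatesIntegral.mono {T m m' c c' γ p : ℝ} {X Y : ℝ → ℝ}
    (h : DominatesIntegral T m c γ p X Y) (hm : m' ≤ m) (hc : c' ≤ c) :
    DominatesIntegral T m' c' γ p X Y := by
  intro t ht
  refine le_trans ?_ (h t ht)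
  have : 0 ≤ ∫ s in (0 : ℝ)..t, (1 + s) ^ (-γ) * |Y s| ^ p := by
    refine intervalIntegral.integral_nonneg ht.1 fun s hs => ?_
    have : 0 ≤ 1 + s := by linarith [hs.1]
    positivity
  gcongr

/-- The weighted moment `exp (-k t) ∫ ∂ₜu(t) m`. -/
noncomputable def moment {N : ℕ} (T k : ℝ) (m : Space N → ℝ) (u : ℝ → H1 N) (t : ℝ) : ℝ :=
  Real.exp (-(k * t)) * ∫ x, timeDeriv T u t x * m x

section Moment

variable {N : ℕ} {T k R r ρ a p : ℝ} {i₀ : Fin N} {m : Space N → ℝ} {u v : ℝ → H1 N}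

lemma IsTruncatedPlaneWave.continuousOn_moment (hm : IsTruncatedPlaneWave k R i₀ m)
    (hu : IsEnergyClass T u) : ContinuousOn (moment T k m u) (Ico 0 T) :=
  (Continuous.continuousOn (by fun_prop)).mul
    (hu.continuousOn_pairing hm.contDiff hm.hasCompactSupport)

/-- The nonlinear term controls a power of the moment. -/
lemma IsTruncatedPlaneWave.rpow_moment_le {G : ℝ → ℝ} (hm : IsTruncatedPlaneWave k R i₀ m)
    (hk : 0 < k) (hρ : 1 ≤ ρ) (hr : r ≤ ρ) (ha : 0 < a) (hp : 1 < p)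
    (hG : ∀ σ, a * |σ| ^ p ≤ G σ) (hv : IsEnergyClass T v) (hsv : SupportedInCone r T v)
    {s : ℝ} (hs : s ∈ Ico 0 T) (hint : Integrable (fun x => G (timeDeriv T v s x))) :
    a * planeMass N k ρ ^ (-(p - 1)) *
        ((1 + s) ^ (-((((N : ℝ) - 1) / 2) * (p - 1))) * |moment T k m v s| ^ p)
      ≤ Real.exp (-(k * s)) * ∫ x, G (timeDeriv T v s x) * m x := by
  have hs1 : 0 < 1 + s := by linarith [hs.1]
  have hC := planeMass_pos (N := N) hk (show 0 < ρ by linarith)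
  obtain ⟨M, hM⟩ := hm.hasCompactSupport.exists_bound_of_continuous hm.contDiff.continuous
  have hGm : Integrable (fun x => G (timeDeriv T v s x) * m x) :=
    hint.mul_bdd hm.contDiff.continuous.aestronglyMeasurable (Filter.Eventually.of_forall hM)
  have hmeas : AEStronglyMeasurable (fun x => |timeDeriv T v s x| ^ p * m x) volume := by
    refine AEStronglyMeasurable.mul ?_ hm.contDiff.continuous.aestronglyMeasurable
    exact (Real.continuous_rpow_const (by linarith)).comp_aestronglyMeasurable
      (continuous_abs.comp_aestronglyMeasurable (Lp.aestronglyMeasurable _))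
  have hple : ∀ x, a * (|timeDeriv T v s x| ^ p * m x) ≤ G (timeDeriv T v s x) * m x := fun x => by
    rw [← mul_assoc]
    exact mul_le_mul_of_nonneg_right (hG _) (hm.nonneg x)
  have hpint : Integrable (fun x => |timeDeriv T v s x| ^ p * m x) := by
    refine (hGm.const_mul a⁻¹).mono' hmeas (Filter.Eventually.of_forall fun x => ?_)
    rw [Real.norm_of_nonneg (mul_nonneg (by positivity) (hm.nonneg x)), inv_mul_eq_div,
      le_div_iff₀ ha, mul_comm]
    exact hple x
  set W := planeMass N k ρ * Real.exp (k * s) * (1 + s) ^ (((N : ℝ) - 1) / 2) with hW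
  have hW0 : 0 < W := by positivity
  set I := ∫ x, timeDeriv T v s x * m x with hI
  have hJ := rpow_abs_integral_le (f := timeDeriv T v s) (m := m)
    (S := Metric.closedBall (0 : Space N) (r + s)) hp measurableSet_closedBall hm.nonneg
    (by
      filter_upwards [hsv.timeDeriv hv hs] with x hx hxS
      exact hx (by simpa using hxS))
    (hm.contDiff.continuous.integrable_of_hasCompactSupport hm.hasCompactSupport).integrableOn
    (integrable_mul_of_L2 hm.contDiff hm.hasCompactSupport _) hpint hW0
    (hm.setIntegral_le hk hρ hr hs.1)
  have hfin : a * (|I| ^ p * W ^ (-(p - 1))) ≤ ∫ x, G (timeDeriv T v s x) * m x := by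
    refine (mul_le_mul_of_nonneg_left hJ ha.le).trans ?_
    rw [← integral_const_mul]
    exact integral_mono (hpint.const_mul a) hGm hple
  refine le_trans (le_of_eq ?_) (mul_le_mul_of_nonneg_left hfin (Real.exp_pos (-(k * s))).le)
  rw [hW, Real.mul_rpow (by positivity) (by positivity),
    Real.mul_rpow hC.le (Real.exp_pos _).le, ← Real.rpow_mul hs1.le, ← Real.exp_mul, moment,
    abs_mul, abs_of_pos (Real.exp_pos _), Real.mul_rpow (Real.exp_pos _).le (abs_nonneg _),
    ← Real.exp_mul]
  -- The exponential growth of the mass in `W^(-(p-1))` is exactly absorbed by the normalization of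
  -- the moment; only the polynomial weight survives.
  have hexp : Real.exp (-(k * s) * p) = Real.exp (-(k * s)) * Real.exp (k * s * -(p - 1)) := by
    rw [← Real.exp_add]
    ring_nf
  rw [hexp, show (((N : ℝ) - 1) / 2) * -(p - 1) = -((((N : ℝ) - 1) / 2) * (p - 1)) by ring]
  ring

/-- The integral inequality linking the moments of the two components of a weak solution. -/
theorem IsTruncatedPlaneWave.dominatesIntegral {G : ℝ → ℝ} {f g : Space N → ℝ} {ε : ℝ}
    (hm : IsTruncatedPlaneWave k R i₀ m) (hk : 0 < k) (hρ : 1 ≤ ρ) (hr : r ≤ ρ)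
    (hR : r + T < R) (ha : 0 < a) (hp : 1 < p) (hG : ∀ σ, a * |σ| ^ p ≤ G σ) (hε : 0 < ε)
    (hu : IsEnergyClass T u) (hv : IsEnergyClass T v)
    (hsu : SupportedInCone r T u) (hsv : SupportedInCone r T v)
    (hmem : MemL1L1 T (fun t x => G (timeDeriv T v t x)))
    (hweak : WeakWaveEquation T u (fun t x => G (timeDeriv T v t x)) (fun x => ε * g x))
    (hinit : valH1 (u 0) =ᵐ[volume] fun x => ε * f x)
    (hf : ∀ x, R ≤ ‖x‖ → f x = 0) (hg : ∀ x, R ≤ ‖x‖ → g x = 0)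
    (hdata : 0 ≤ (∫ x, g x * Real.exp (k * x i₀)) - k * ∫ x, f x * Real.exp (k * x i₀)) :
    DominatesIntegral T
      (ε * (((∫ x, g x * Real.exp (k * x i₀)) + k * ∫ x, f x * Real.exp (k * x i₀)) / 2))
      (a / 2 * planeMass N k ρ ^ (-(p - 1))) ((((N : ℝ) - 1) / 2) * (p - 1)) p
      (moment T k m u) (moment T k m v) := by
  intro t ht
  have hcut : ∀ φ : Space N → ℝ, (∀ x, R ≤ ‖x‖ → φ x = 0) →
      ∫ x, ε * φ x * m x = ε * ∫ x, φ x * Real.exp (k * x i₀) := by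
    intro φ hφ
    rw [← integral_const_mul]
    congr 1
    ext x
    rcases lt_or_ge ‖x‖ R with h | h
    · rw [hm.eq_exp x h]; ring
    · simp [hφ x h]
  have hB0 : ∫ x, valH1 (u 0) x * m x = ε * ∫ x, f x * Real.exp (k * x i₀) := by
    rw [← hcut f hf]
    refine integral_congr_ae ?_
    filter_upwards [hinit] with x hx
    rw [hx]
  have hG0 : ∀ σ, 0 ≤ G σ := fun σ => le_trans (by positivity) (hG σ)
  have hduh := exp_weighted_duhamel_le (k := k) (A₀ := ∫ x, ε * g x * m x)
    (A := fun s => ∫ x, timeDeriv T u s x * m x) (B := fun s => ∫ x, valH1 (u s) x * m x)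
    (H := fun s => ∫ x, G (timeDeriv T v s x) * m x)
    (hu.continuousOn_pairing hm.contDiff hm.hasCompactSupport)
    (fun s hs => hu.hasDerivWithinAt_pairing hm.contDiff hm.hasCompactSupport hs)
    (hmem.integrableOn_pairing hm.contDiff hm.hasCompactSupport)
    (Filter.Eventually.of_forall fun s =>
      integral_nonneg fun x => mul_nonneg (hG0 _) (hm.nonneg x))
    (fun η h1 h2 h3 => hweak.moment hm hR hsu h1 h2 h3)
    (by
      simp only [hB0, hcut g hg]
      have := mul_nonneg hε.le hdata
      linarith) ht
  simp only [hB0, hcut g hg] at hduh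
  refine le_trans ?_ hduh
  have hsub : Ioc 0 t ⊆ Ioo 0 T := fun x hx => ⟨hx.1, hx.2.trans_lt ht.2⟩
  have hcont : ContinuousOn (fun s => (1 + s) ^ (-((((N : ℝ) - 1) / 2) * (p - 1))) *
      |moment T k m v s| ^ p) (Icc 0 t) := by
    refine ContinuousOn.mul ?_ ?_
    · refine ContinuousOn.rpow_const (by fun_prop) fun s hs => Or.inl ?_
      have := hs.1
      positivity
    · exact (((hm.continuousOn_moment hv).mono
        fun s hs => ⟨hs.1, hs.2.trans_lt ht.2⟩).abs).rpow_const fun s _ => Or.inr (by linarith)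
  have hHint : IntegrableOn (fun s => Real.exp (-(k * s)) * ∫ x, G (timeDeriv T v s x) * m x)
      (Ioc 0 t) := by
    obtain ⟨M, hM⟩ := (isCompact_Icc (a := 0) (b := t)).exists_bound_of_continuousOn
      (f := fun s => Real.exp (-(k * s))) (Continuous.continuousOn (by fun_prop))
    refine ((hmem.integrableOn_pairing hm.contDiff hm.hasCompactSupport).mono_set hsub).bdd_mul
      (Continuous.aestronglyMeasurable (by fun_prop)) (c := M) ?_
    filter_upwards [ae_restrict_mem measurableSet_Ioc] with s hs using hM s ⟨hs.1.le, hs.2⟩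
  have hmono : a * planeMass N k ρ ^ (-(p - 1)) * ∫ s in (0 : ℝ)..t,
      (1 + s) ^ (-((((N : ℝ) - 1) / 2) * (p - 1))) * |moment T k m v s| ^ p
      ≤ ∫ s in Ioc 0 t, Real.exp (-(k * s)) * ∫ x, G (timeDeriv T v s x) * m x := by
    rw [intervalIntegral.integral_of_le ht.1, ← integral_const_mul]
    refine integral_mono_ae ((hcont.integrableOn_Icc.mono_set Ioc_subset_Icc_self).const_mul _)
      hHint ?_
    filter_upwards [ae_restrict_of_ae_restrict_of_subset hsub hmem.ae_integrable,
      ae_restrict_mem measurableSet_Ioc] with s h1 h2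
    exact hm.rpow_moment_le hk hρ hr ha hp hG hv hsv ⟨h2.1.le, (hsub h2).2⟩ h1
  linarith

end Moment

/-! ### Positivity of the data and the three lifespan bounds -/

/-- For small `k > 0` the exponentially weighted data remain positive. -/
lemma eventually_weighted_data_pos {N : ℕ} {f g : Space N → ℝ} (i₀ : Fin N)
    (hf : Continuous f) (hfc : HasCompactSupport f) (hg : Continuous g)
    (hgc : HasCompactSupport g) (hI : 0 < ∫ x, g x) :
    ∀ᶠ k : ℝ in nhds 0,
      0 < (∫ x, g x * Real.exp (k * x i₀)) - k * ∫ x, f x * Real.exp (k * x i₀) ∧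
      0 < (∫ x, g x * Real.exp (k * x i₀)) + k * ∫ x, f x * Real.exp (k * x i₀) := by
  have hcont : ∀ φ : Space N → ℝ, Continuous φ → HasCompactSupport φ →
      Continuous (fun k : ℝ => ∫ x, φ x * Real.exp (k * x i₀)) := by
    intro φ hφ hφc
    have h1 := continuous_parametric_integral_of_continuous (μ := (volume : Measure (Space N)))
      (f := fun (k : ℝ) x => φ x * Real.exp (k * x i₀)) (by
        simp only [Function.uncurry_def]
        fun_prop) hφc
    convert h1 using 2 with k
    refine (setIntegral_eq_integral_of_forall_compl_eq_zero fun x hx => ?_).symm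
    rw [image_eq_zero_of_notMem_tsupport hx, zero_mul]
  have hgk := hcont g hg hgc
  have hfk := hcont f hf hfc
  have h1 : ContinuousAt (fun k : ℝ => (∫ x, g x * Real.exp (k * x i₀))
      - k * ∫ x, f x * Real.exp (k * x i₀)) 0 := by fun_prop
  have h2 : ContinuousAt (fun k : ℝ => (∫ x, g x * Real.exp (k * x i₀))
      + k * ∫ x, f x * Real.exp (k * x i₀)) 0 := by fun_prop
  filter_upwards [h1.eventually (lt_mem_nhds (a := 0) (by simpa using hI)),
    h2.eventually (lt_mem_nhds (a := 0) (by simpa using hI))] with k h3 h4 using ⟨h3, h4⟩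

lemma FGG_mul_sub_one {N : ℕ} {p q : ℝ} (hpq : 0 < p * q - 1) :
    p + 1 - ((N : ℝ) - 1) / 2 * (p * q - 1) = FGG N p q * (p * q - 1) := by
  rw [FGG, sub_mul, div_mul_cancel₀ _ hpq.ne']

/-- Starting at `τ₀ = ε^(-1/F_GG)` makes `τ₀^θ (ε d)^(pq-1)` independent of `ε`, since `θ = F_GG
(pq-1)`; the exponential factor is then a constant. The condition `ε ≤ 1` ensures `τ₀ ≥ 1`. -/
theorem exists_lifespan_le_rpow {N : ℕ} {p q c d : ℝ} (hN : 1 ≤ N) (hp : 1 < p) (hq : 1 < q)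
    (hc : 0 < c) (hd : 0 < d) (hΓ : 0 < FGG N p q) :
    ∃ C : ℝ, 0 < C ∧ ∀ ε, 0 < ε → ε ≤ 1 → ∀ (T : ℝ) (X Y : ℝ → ℝ),
      ContinuousOn X (Ico 0 T) → ContinuousOn Y (Ico 0 T) →
      DominatesIntegral T (ε * d) c (((N : ℝ) - 1) / 2 * (p - 1)) p X Y →
      DominatesIntegral T (ε * d) c (((N : ℝ) - 1) / 2 * (q - 1)) q Y X →
      T ≤ C * ε ^ (-(FGG N p q)⁻¹) := by
  have hpq : 0 < p * q - 1 := by nlinarith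
  have hN' : (1 : ℝ) ≤ N := by exact_mod_cast hN
  have hθ := FGG_mul_sub_one (N := N) hpq
  obtain ⟨K, -, hK⟩ := exists_lifespan_bound (κ := ((N : ℝ) - 1) / 2) hp hq
    (by linarith) (by rw [hθ]; positivity) hc
  refine ⟨Real.exp (K * ((d ^ (p * q - 1))⁻¹ + ((d ^ (p * q - 1))⁻¹) ^ (1 / (p + 1)))),
    Real.exp_pos _, fun ε hε hε1 T X Y hX hY hXd hYd => ?_⟩
  have hΓ' : -(FGG N p q)⁻¹ ≤ 0 := by
    have := inv_pos.2 hΓ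
    linarith
  have h := hK T _ _ (ε * d) (ε ^ (-(FGG N p q)⁻¹)) X Y (by positivity) (by positivity)
    (by positivity) (Real.one_le_rpow_of_pos_of_le_one_of_nonpos hε hε1 hΓ') le_rfl hX hY hXd hYd
  have hE : (ε ^ (-(FGG N p q)⁻¹)) ^ (p + 1 - ((N : ℝ) - 1) / 2 * (p * q - 1)) *
      (ε * d) ^ (p * q - 1) = d ^ (p * q - 1) := by
    rw [hθ, ← Real.rpow_mul hε.le, Real.mul_rpow hε.le hd.le, ← mul_assoc, ← Real.rpow_add hε,
      show -(FGG N p q)⁻¹ * (FGG N p q * (p * q - 1)) + (p * q - 1) = 0 by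
        field_simp
        ring, Real.rpow_zero, one_mul]
  rw [hE] at h
  linarith

theorem exists_lifespan_le_exp {N : ℕ} {p q c d : ℝ} (hN : 1 ≤ N) (hp : 1 < p) (hq : 1 < q)
    (hc : 0 < c) (hd : 0 < d) (hΓ : FGG N p q = 0) :
    ∃ C : ℝ, 0 < C ∧ ∀ ε, 0 < ε → ε ≤ 1 → ∀ (T : ℝ) (X Y : ℝ → ℝ),
      ContinuousOn X (Ico 0 T) → ContinuousOn Y (Ico 0 T) →
      DominatesIntegral T (ε * d) c (((N : ℝ) - 1) / 2 * (p - 1)) p X Y →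
      DominatesIntegral T (ε * d) c (((N : ℝ) - 1) / 2 * (q - 1)) q Y X →
      T ≤ Real.exp (C * ε ^ (-(p * q - 1))) := by
  have hpq : 0 < p * q - 1 := by nlinarith
  have hN' : (1 : ℝ) ≤ N := by exact_mod_cast hN
  have hθ := FGG_mul_sub_one (N := N) hpq
  rw [hΓ, zero_mul] at hθ
  obtain ⟨K, hK0, hK⟩ := exists_lifespan_bound (κ := ((N : ℝ) - 1) / 2) hp hq
    (by linarith) hθ.ge hc
  -- The `2` and the `1` come from `z^(1/(p+1)) ≤ 1 + z`; the `1` is absorbed into `ε^(-(pq-1)) ≥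
  -- 1`.
  refine ⟨K * (2 * d ^ (-(p * q - 1)) + 1), by positivity, fun ε hε hε1 T X Y hX hY hXd hYd => ?_⟩
  have h := hK T _ _ (ε * d) 1 X Y (by positivity) (by positivity)
    (by positivity) le_rfl le_rfl hX hY hXd hYd
  rw [Real.one_rpow, one_mul, one_mul] at h
  refine le_trans (by linarith) (h.trans (Real.exp_le_exp.2 ?_))
  rw [mul_assoc]
  refine mul_le_mul_of_nonneg_left ?_ hK0.le
  rw [← Real.rpow_neg (by positivity), Real.mul_rpow hε.le hd.le]
  set z := ε ^ (-(p * q - 1)) * d ^ (-(p * q - 1)) with hz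
  have hz0 : 0 < z := by positivity
  have h1 : 1 ≤ ε ^ (-(p * q - 1)) :=
    Real.one_le_rpow_of_pos_of_le_one_of_nonpos hε hε1 (by linarith)
  have h2 : z ^ (1 / (p + 1)) ≤ 1 + z := by
    calc z ^ (1 / (p + 1)) ≤ (1 + z) ^ (1 / (p + 1)) := by gcongr; linarith
      _ ≤ (1 + z) ^ (1 : ℝ) := by
        refine Real.rpow_le_rpow_of_exponent_le (by linarith) ?_
        rw [div_le_one (by linarith)]
        linarith
      _ = 1 + z := Real.rpow_one _
  have h3 : (2 * d ^ (-(p * q - 1)) + 1) * ε ^ (-(p * q - 1)) = 2 * z + ε ^ (-(p * q - 1)) := by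
    rw [hz]; ring
  linarith

theorem exists_lifespan_le_exp_of_eq {N : ℕ} {p c d : ℝ} (hp : 1 < p)
    (hc : 0 < c) (hd : 0 < d) (hΓ : FGG N p p = 0) :
    ∃ C : ℝ, 0 < C ∧ ∀ ε, 0 < ε → ∀ (T : ℝ) (X Y : ℝ → ℝ),
      ContinuousOn X (Ico 0 T) → ContinuousOn Y (Ico 0 T) →
      DominatesIntegral T (ε * d) c (((N : ℝ) - 1) / 2 * (p - 1)) p X Y →
      DominatesIntegral T (ε * d) c (((N : ℝ) - 1) / 2 * (p - 1)) p Y X →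
      T ≤ Real.exp (C * ε ^ (-(p - 1))) := by
  have hκ : ((N : ℝ) - 1) / 2 * (p - 1) = 1 := by
    have h := FGG_mul_sub_one (N := N) (p := p) (q := p) (by nlinarith)
    rw [hΓ, zero_mul] at h
    -- For `p = q` the critical relation factorizes, so the weight exponent is exactly `1`.
    have h1 : (p + 1) * (1 - ((N : ℝ) - 1) / 2 * (p - 1)) = 0 := by linarith
    rcases mul_eq_zero.1 h1 with h2 | h2 <;> linarith
  have hr1 : (2 : ℝ) ^ (-(p - 1)) < 1 :=
    Real.rpow_lt_one_of_one_lt_of_neg one_lt_two (by linarith)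
  have hr : 0 < 1 - (2 : ℝ) ^ (-(p - 1)) := by linarith
  refine ⟨2 / c * (1 - 2 ^ (-(p - 1)))⁻¹ * d ^ (-(p - 1)), by positivity,
    fun ε hε T X Y hX hY hXd hYd => ?_⟩
  rw [hκ] at hXd hYd
  have h := lifespan_bound_of_log_weight hp hc (by positivity) hX hY hXd hYd
  rw [Real.mul_rpow hε.le hd.le] at h
  refine le_trans (by linarith) (h.trans (le_of_eq ?_))
  congr 1
  ring

/-- All three lifespan bounds, for the coupled integral inequalities. -/
theorem exists_lifespan_GammaGG {N : ℕ} {p q c d : ℝ} (hN : 1 ≤ N) (hp : 1 < p) (hq : 1 < q)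
    (hc : 0 < c) (hd : 0 < d) :
    ∃ C : ℝ, 0 < C ∧ ∀ ε, 0 < ε → ε ≤ 1 → ∀ (T : ℝ) (X Y : ℝ → ℝ),
      ContinuousOn X (Ico 0 T) → ContinuousOn Y (Ico 0 T) →
      DominatesIntegral T (ε * d) c (((N : ℝ) - 1) / 2 * (p - 1)) p X Y →
      DominatesIntegral T (ε * d) c (((N : ℝ) - 1) / 2 * (q - 1)) q Y X →
      (0 < GammaGG N p q → T ≤ C * ε ^ (-(GammaGG N p q)⁻¹)) ∧
      (GammaGG N p q = 0 → p ≠ q → T ≤ Real.exp (C * ε ^ (-(p * q - 1)))) ∧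
      (GammaGG N p q = 0 → p = q → T ≤ Real.exp (C * ε ^ (-(p - 1)))) := by
  have hmax : GammaGG N p q = FGG N p q ∨ GammaGG N p q = FGG N q p := max_choice _ _
  rcases lt_trichotomy (GammaGG N p q) 0 with hneg | hzero | hpos
  · exact ⟨1, one_pos, fun ε _ _ T X Y _ _ _ _ =>
      ⟨fun h => absurd h hneg.le.not_gt, fun h => absurd h hneg.ne, fun h => absurd h hneg.ne⟩⟩
  · by_cases hpq : p = q
    · subst hpq
      have hΓ : FGG N p p = 0 := by simpa [GammaGG] using hzero
      obtain ⟨C, hC, h⟩ := exists_lifespan_le_exp_of_eq hp hc hd hΓ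
      exact ⟨C, hC, fun ε hε _ T X Y hX hY hXd hYd =>
        ⟨fun h0 => absurd hzero h0.ne', fun _ h0 => absurd rfl h0,
          fun _ _ => h ε hε T X Y hX hY hXd hYd⟩⟩
    · rcases hmax with hm | hm
      · obtain ⟨C, hC, h⟩ := exists_lifespan_le_exp hN hp hq hc hd (hm.symm.trans hzero)
        exact ⟨C, hC, fun ε hε hε1 T X Y hX hY hXd hYd =>
          ⟨fun h0 => absurd hzero h0.ne', fun _ _ => h ε hε hε1 T X Y hX hY hXd hYd,
            fun _ h0 => absurd h0 hpq⟩⟩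
      · obtain ⟨C, hC, h⟩ := exists_lifespan_le_exp hN hq hp hc hd (hm.symm.trans hzero)
        -- When the maximum is `F_GG(N,q,p)`, the components exchange roles.
        rw [mul_comm q p] at h
        exact ⟨C, hC, fun ε hε hε1 T X Y hX hY hXd hYd =>
          ⟨fun h0 => absurd hzero h0.ne', fun _ _ => h ε hε hε1 T Y X hY hX hYd hXd,
            fun _ h0 => absurd h0 hpq⟩⟩
  · rcases hmax with hm | hm
    · obtain ⟨C, hC, h⟩ := exists_lifespan_le_rpow hN hp hq hc hd (hm ▸ hpos)
      exact ⟨C, hC, fun ε hε hε1 T X Y hX hY hXd hYd =>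
        ⟨fun _ => hm ▸ h ε hε hε1 T X Y hX hY hXd hYd, fun h0 => absurd h0 hpos.ne',
          fun h0 => absurd h0 hpos.ne'⟩⟩
    · obtain ⟨C, hC, h⟩ := exists_lifespan_le_rpow hN hq hp hc hd (hm ▸ hpos)
      exact ⟨C, hC, fun ε hε hε1 T X Y hX hY hXd hYd =>
        ⟨fun _ => hm ▸ h ε hε hε1 T Y X hY hX hYd hXd, fun h0 => absurd h0 hpos.ne',
          fun h0 => absurd h0 hpos.ne'⟩⟩

/-! ### Proof of the theorem -/

lemma exists_radius {N : ℕ} {f : Space N → ℝ} (hf : HasCompactSupport f) :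
    ∃ ρ : ℝ, ∀ x, ρ < ‖x‖ → f x = 0 := by
  obtain ⟨ρ, hρ⟩ := hf.isCompact.isBounded.exists_norm_le
  exact ⟨ρ, fun x hx => image_eq_zero_of_notMem_tsupport fun h => (hρ x h).not_gt hx⟩

end WaveSystem

open WaveSystem

theorem mainTheorem2 (N : ℕ) (hN : 1 ≤ N) (p q : ℝ) (hp : 1 < p) (hq : 1 < q)
    (a b : ℝ) (ha : 0 < a) (hb : 0 < b)
    (G₁ G₂ : ℝ → ℝ) (hG₁ : ContDiff ℝ 1 G₁) (hG₂ : ContDiff ℝ 1 G₂)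
    (hG₁0 : G₁ 0 = 0) (hG₂0 : G₂ 0 = 0)
    (hG₁p : ∀ σ : ℝ, a * |σ| ^ p ≤ G₁ σ) (hG₂q : ∀ σ : ℝ, b * |σ| ^ q ≤ G₂ σ)
    (f₁ g₁ f₂ g₂ : Space N → ℝ)
    (hf₁ : ContDiff ℝ ∞ f₁) (hf₁c : HasCompactSupport f₁)
    (hg₁ : ContDiff ℝ ∞ g₁) (hg₁c : HasCompactSupport g₁)
    (hf₂ : ContDiff ℝ ∞ f₂) (hf₂c : HasCompactSupport f₂)
    (hg₂ : ContDiff ℝ ∞ g₂) (hg₂c : HasCompactSupport g₂)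
    (hI₁ : 0 < ∫ x, g₁ x) (hI₂ : 0 < ∫ x, g₂ x)
    (hΓ : 0 ≤ GammaGG N p q) :
    ∃ ε₀ C : ℝ, 0 < ε₀ ∧ 0 < C ∧
      ∀ ε : ℝ, 0 < ε → ε ≤ ε₀ →
      ∀ T : ℝ, 0 < T →
      ∀ u v : ℝ → H1 N, IsWeakSolution G₁ G₂ f₁ g₁ f₂ g₂ ε T u v →
        SupportedInCone (dataRadius f₁ g₁ f₂ g₂) T u →
        SupportedInCone (dataRadius f₁ g₁ f₂ g₂) T v →
        (0 < GammaGG N p q → T ≤ C * ε ^ (-(GammaGG N p q)⁻¹)) ∧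
        (GammaGG N p q = 0 → p ≠ q → T ≤ Real.exp (C * ε ^ (-(p * q - 1)))) ∧
        (GammaGG N p q = 0 → p = q → T ≤ Real.exp (C * ε ^ (-(p - 1)))) := by
  -- One `k > 0` serves both components, and it depends on the data only.
  obtain ⟨k, ⟨⟨hk1, hk2⟩, ⟨hk3, hk4⟩⟩, hk⟩ :=
    ((((eventually_weighted_data_pos ⟨0, hN⟩ hf₁.continuous hf₁c hg₁.continuous hg₁c hI₁).and
      (eventually_weighted_data_pos ⟨0, hN⟩ hf₂.continuous hf₂c hg₂.continuous hg₂c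
        hI₂)).filter_mono nhdsWithin_le_nhds).and
      (self_mem_nhdsWithin (s := Ioi (0 : ℝ)))).exists
  set i₀ : Fin N := ⟨0, hN⟩
  set d₁ := ((∫ x, g₁ x * Real.exp (k * x i₀)) + k * ∫ x, f₁ x * Real.exp (k * x i₀)) / 2 with hd₁
  set d₂ := ((∫ x, g₂ x * Real.exp (k * x i₀)) + k * ∫ x, f₂ x * Real.exp (k * x i₀)) / 2 with hd₂
  set r := dataRadius f₁ g₁ f₂ g₂
  set ρ := max 1 r with hρ
  have hρ1 : 1 ≤ ρ := le_max_left _ _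
  have hC : 0 < planeMass N k ρ := planeMass_pos hk (by linarith)
  set c₁ := a / 2 * planeMass N k ρ ^ (-(p - 1)) with hc₁
  set c₂ := b / 2 * planeMass N k ρ ^ (-(q - 1)) with hc₂
  have hc₁0 : 0 < c₁ := by positivity
  have hc₂0 : 0 < c₂ := by positivity
  have hd₁0 : 0 < d₁ := by rw [hd₁]; linarith
  have hd₂0 : 0 < d₂ := by rw [hd₂]; linarith
  obtain ⟨C, hC0, hlife⟩ := exists_lifespan_GammaGG hN hp hq (c := min c₁ c₂) (d := min d₁ d₂)
    (lt_min hc₁0 hc₂0) (lt_min hd₁0 hd₂0)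
  refine ⟨1, C, one_pos, hC0, fun ε hε hε1 T hT u v hsol hsu hsv => ?_⟩
  obtain ⟨ρ₁, hρ₁⟩ := exists_radius hf₁c
  obtain ⟨ρ₂, hρ₂⟩ := exists_radius hg₁c
  obtain ⟨ρ₃, hρ₃⟩ := exists_radius hf₂c
  obtain ⟨ρ₄, hρ₄⟩ := exists_radius hg₂c
  -- Beyond the cone up to time `T` and beyond all data supports. `R` and the cutoff depend on `T`,
  -- but the constants `c₁, c₂, d₁, d₂` involve only `k`, `ρ`, `a`, `b`, `p`, `q`, `N` and the data.
  set R := ρ + T + |ρ₁| + |ρ₂| + |ρ₃| + |ρ₄| + 1 with hRdef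
  have e₁ := le_abs_self ρ₁
  have e₂ := le_abs_self ρ₂
  have e₃ := le_abs_self ρ₃
  have e₄ := le_abs_self ρ₄
  have n₁ := abs_nonneg ρ₁
  have n₂ := abs_nonneg ρ₂
  have n₃ := abs_nonneg ρ₃
  have n₄ := abs_nonneg ρ₄
  have hrρ : r ≤ ρ := le_max_right _ _
  have hR0 : 0 < R := by linarith
  have hrR : r + T < R := by linarith
  obtain ⟨m, hm⟩ := exists_isTruncatedPlaneWave k hR0 i₀
  have h₁ := hm.dominatesIntegral (f := f₁) (g := g₁) hk hρ1 hrρ hrR ha hp hG₁p hε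
    hsol.energy_u hsol.energy_v hsu hsv hsol.memL1_v hsol.weak_u hsol.init_u
    (fun x hx => hρ₁ x (by linarith)) (fun x hx => hρ₂ x (by linarith)) hk1.le
  have h₂ := hm.dominatesIntegral (f := f₂) (g := g₂) hk hρ1 hrρ hrR hb hq hG₂q hε
    hsol.energy_v hsol.energy_u hsv hsu hsol.memL1_u hsol.weak_v hsol.init_v
    (fun x hx => hρ₃ x (by linarith)) (fun x hx => hρ₄ x (by linarith)) hk3.le
  exact hlife ε hε hε1 T _ _ (hm.continuousOn_moment hsol.energy_u)
    (hm.continuousOn_moment hsol.energy_v)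
    (h₁.mono (by gcongr; exact min_le_left _ _) (min_le_left _ _))
    (h₂.mono (by gcongr; exact min_le_right _ _) (min_le_right _ _))
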